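/- Let $\mathfrak A$ be a complex Banach algebra, $\mathcal H$ a complex Hilbert space, and $p\ge 0$ an integer. For a bounded operator $T$ on $\mathcal H$ and $k\ge 0$ let $\mu_k(T)$ be the distance in operator norm from $T$ to the operators of rank at most $k$. For $q>0$ let $\mathcal L^{q,\infty}(\mathcal H)$ be the space of compact $T$ with $\mu_k(T)=O(k^{-1/q})$, with quasi-norm $\sup_k (k+1)^{1/q}\mu_k(T)$, and let $\mathcal L^{q,\infty}_0(\mathcal H)$ be the closure of the finite rank operators in it. Let $(\pi,\mathcal H,F)$ be a strict $(p+1,\infty)$-summable Fredholm module on $\mathfrak A$ of the parity of $p$. That is, $\pi:\mathfrak A\to\mathbb B(\mathcal H)$ is a continuous algebra homomorphism and $F\in\mathbb B(\mathcal H)$ satisfies $[F,b]\in\mathcal L^{p+1,\infty}(\mathcal H)$ and $b(F^*-F)=b(F^2-1)=0$ for all $b\in\pi(\mathfrak A)\cup\pi(\mathfrak A)^*$. If $p$ is even, $\mathcal H$ is moreover $\mathbb Z/2$-graded by a self-adjoint unitary $\gamma$ which anticommutes with $F$ and commutes with $\pi(\mathfrak A)$. If $p$ is odd, there is no grading and we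 put $\gamma=1$. Let $\omega$ be an extended limit, that is, a state on $\ell^\infty(\mathbb N)$ annihilating $c_0(\mathbb N)$. Let $\mathrm{Tr}_\omega$ be the associated Dixmier trace on $\mathcal L^{1,\infty}(\mathcal H)$, that is, the linear extension of $T\mapsto\omega\big(\big(\frac1{\log(2+N)}\sum_{k=0}^N\mu_k(T)\big)_N\big)$, $T\ge 0$. Put $\mathrm{STr}_\omega(T)=\mathrm{Tr}_\omega(\gamma T)$. Writing $a$ for $\pi(a)$, set $$\mathfrak h_\omega(a_0,\dots,a_{p+1})=p\,\mathrm{STr}_\omega\big(Fa_0[F,a_1]\cdots[F,a_{p+1}]\big),\qquad \mathfrak c_\omega(a_0,\dots,a_p)=\mathrm{STr}_\omega\big(F[F,a_0]\cdots[F,a_p]\big).$$ For a Banach algebra $\mathfrak B$ let $C^n(\mathfrak B)$ be the space of bounded $(n+1)$-linear functionals on $\mathfrak B$, with coboundary $$(b\varphi)(a_0,\dots,a_{n+1})=\sum_{j=0}^{n}(-1)^j\varphi(a_0,\dots,a_ja_{j+1},\dots,a_{n+1})+(-1)^{n+1}\varphi(a_{n+1}a_0,a_1,\dots,a_n),$$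 and let $C^n_\lambda(\mathfrak B)\subseteq C^n(\mathfrak B)$ be the subcomplex of those $\varphi$ with $\varphi(a_0,\dots,a_n)=(-1)^n\varphi(a_1,\dots,a_n,a_0)$. Let $HH^*(\mathfrak B)$ and $HC^*_\lambda(\mathfrak B)$ be the cohomology of $(C^*(\mathfrak B),b)$ and of $(C^*_\lambda(\mathfrak B),b)$. Let $\mathfrak A_0\subseteq\mathfrak A$ be a Banach subalgebra, that is, a subalgebra that is a Banach algebra in some norm for which the inclusion $j:\mathfrak A_0\hookrightarrow\mathfrak A$ is continuous, and assume that $[F,a]\in\mathcal L^{p+1,\infty}_0(\mathcal H)$ for all $a\in\mathfrak A_0$. Then $\mathfrak h_\omega$ is a bounded Hochschild $(p+1)$-cocycle on $\mathfrak A$, $\mathfrak c_\omega$ is a bounded cyclic $p$-cocycle on $\mathfrak A$, and their classes satisfy $$j^*[\mathfrak h_\omega]=0\in HH^{p+1}(\mathfrak A_0),\qquad j^*[\mathfrak c_\omega]=0\in HC^p_\lambda(\mathfrak A_0).$$ -/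

import Mathlib

open Filter Topology Asymptotics
open scoped ENNReal ComplexOrder

noncomputable section

namespace SingChern

/-! ### Hochschild and cyclic cohomology of Banach algebras -/

section Cohomology

set_option linter.unusedSectionVars false

/-- `C^n(A)`: bounded `(n+1)`-linear functionals on `A`, that is, the dual of the
`(n+1)`-fold projective tensor power of `A`. -/
abbrev Cochain (A : Type*) [NonUnitalNormedRing A] [NormedSpace ℂ A] (n : ℕ) : Type _ :=
  ContinuousMultilinearMap ℂ (fun _ : Fin (n + 1) => A) ℂ

/-- `(a₀, …, a_{n+1}) ↦ (a₀, …, a_j a_{j+1}, …, a_{n+1})` for `0 ≤ j ≤ n`. -/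
def face {A : Type*} [Mul A] {n : ℕ} (j : Fin (n + 1)) (a : Fin (n + 2) → A) :
    Fin (n + 1) → A := fun i =>
  if i < j then a i.castSucc else if i = j then a i.castSucc * a i.succ else a i.succ

/-- `(a₀, …, a_{n+1}) ↦ (a_{n+1} a₀, a₁, …, a_n)`. -/
def lastFace {A : Type*} [Mul A] {n : ℕ} (a : Fin (n + 2) → A) : Fin (n + 1) → A := fun i =>
  if i = 0 then a (Fin.last (n + 1)) * a 0 else a i.castSucc

variable {A : Type*} [NonUnitalNormedRing A] [NormedSpace ℂ A] [IsScalarTower ℂ A A]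
  [SMulCommClass ℂ A A]
variable {A₀ : Type*} [NonUnitalNormedRing A₀] [NormedSpace ℂ A₀] [IsScalarTower ℂ A₀ A₀]
  [SMulCommClass ℂ A₀ A₀]

theorem face_update {n : ℕ} (j : Fin (n + 1)) (a : Fin (n + 2) → A) (m : Fin (n + 2)) :
    ∃ (i : Fin (n + 1)) (g : A →ₗ[ℂ] A), ∀ x : A,
      face j (Function.update a m x) = Function.update (face j a) i (g x) := by
  rcases lt_trichotomy m j.castSucc with h | h | h
  · refine ⟨⟨m, by have := j.2; simp [Fin.lt_def] at h; omega⟩, LinearMap.id, fun x => ?_⟩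
    funext i
    simp only [face, Function.update_apply, Fin.ext_iff, Fin.lt_def, LinearMap.id_apply,
      Fin.val_castSucc, Fin.val_succ] at h ⊢
    grind
  · refine ⟨j, LinearMap.mulRight ℂ (a j.succ), fun x => ?_⟩
    subst h
    funext i
    simp only [face, Function.update_apply, Fin.ext_iff, Fin.lt_def, LinearMap.mulRight_apply,
      Fin.val_castSucc, Fin.val_succ]
    grind
  · by_cases h' : m = j.succ
    · refine ⟨j, LinearMap.mulLeft ℂ (a j.castSucc), fun x => ?_⟩
      subst h'
      funext i
      simp only [face, Function.update_apply, Fin.ext_iff, Fin.lt_def, LinearMap.mulLeft_apply,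
        Fin.val_castSucc, Fin.val_succ]
      grind
    · refine ⟨⟨m - 1, by have := m.2; simp [Fin.lt_def] at h; omega⟩, LinearMap.id,
        fun x => ?_⟩
      funext i
      simp only [face, Function.update_apply, Fin.ext_iff, Fin.lt_def, LinearMap.id_apply,
        Fin.val_castSucc, Fin.val_succ] at h h' ⊢
      grind

theorem lastFace_update {n : ℕ} (a : Fin (n + 2) → A) (m : Fin (n + 2)) :
    ∃ (i : Fin (n + 1)) (g : A →ₗ[ℂ] A), ∀ x : A,
      lastFace (Function.update a m x) = Function.update (lastFace a) i (g x) := by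
  by_cases h : m = Fin.last (n + 1)
  · refine ⟨0, LinearMap.mulRight ℂ (a 0), fun x => ?_⟩
    subst h
    funext i
    have := i.2
    simp only [lastFace, Function.update_apply, Fin.ext_iff, LinearMap.mulRight_apply,
      Fin.val_castSucc, Fin.val_last, Fin.val_zero]
    grind
  · by_cases h0 : m = 0
    · refine ⟨0, LinearMap.mulLeft ℂ (a (Fin.last (n + 1))), fun x => ?_⟩
      subst h0
      funext i
      simp only [lastFace, Function.update_apply, Fin.ext_iff, LinearMap.mulLeft_apply,
        Fin.val_castSucc, Fin.val_last, Fin.val_zero]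
      grind
    · refine ⟨⟨m, by have := m.2; simp [Fin.ext_iff] at h; omega⟩, LinearMap.id, fun x => ?_⟩
      funext i
      simp only [lastFace, Function.update_apply, Fin.ext_iff, LinearMap.id_apply,
        Fin.val_castSucc, Fin.val_last, Fin.val_zero] at h h0 ⊢
      grind

theorem continuous_face {n : ℕ} (j : Fin (n + 1)) :
    Continuous (face j : (Fin (n + 2) → A) → Fin (n + 1) → A) := by
  refine continuous_pi fun i => ?_
  simp only [face]
  split_ifs <;> fun_prop

theorem continuous_lastFace {n : ℕ} :
    Continuous (lastFace : (Fin (n + 2) → A) → Fin (n + 1) → A) := by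
  refine continuous_pi fun i => ?_
  simp only [lastFace]
  split_ifs <;> fun_prop

/-- The cochain `a ↦ φ (G a)`, for a map `G` of tuples that is affected by a change of one
entry in one entry only, linearly. -/
def compTuple {n m : ℕ} (φ : Cochain A n) (G : (Fin (m + 1) → A) → Fin (n + 1) → A)
    (hc : Continuous G)
    (hG : ∀ (a : Fin (m + 1) → A) (k : Fin (m + 1)), ∃ (i : Fin (n + 1)) (g : A →ₗ[ℂ] A),
      ∀ x : A, G (Function.update a k x) = Function.update (G a) i (g x)) : Cochain A m where
  toFun a := φ (G a)
  map_update_add' {inst} a k x y := by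
    obtain rfl : inst = instDecidableEqFin (m + 1) := Subsingleton.elim _ _
    obtain ⟨i, g, h⟩ := hG a k
    rw [h, h, h, map_add, φ.map_update_add]
  map_update_smul' {inst} a k c x := by
    obtain rfl : inst = instDecidableEqFin (m + 1) := Subsingleton.elim _ _
    obtain ⟨i, g, h⟩ := hG a k
    rw [h, h, map_smul, φ.map_update_smul]
  cont := φ.cont.comp hc

theorem compTuple_apply {n m : ℕ} (φ : Cochain A n) (G : (Fin (m + 1) → A) → Fin (n + 1) → A)
    (hc : Continuous G)
    (hG : ∀ (a : Fin (m + 1) → A) (k : Fin (m + 1)), ∃ (i : Fin (n + 1)) (g : A →ₗ[ℂ] A),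
      ∀ x : A, G (Function.update a k x) = Function.update (G a) i (g x))
    (a : Fin (m + 1) → A) : compTuple φ G hc hG a = φ (G a) := rfl

/-- The Hochschild coboundary `b : C^n(A) → C^{n+1}(A)`,
`(bφ)(a₀,…,a_{n+1}) = ∑_{j=0}^{n} (-1)^j φ(a₀,…,a_j a_{j+1},…,a_{n+1})
  + (-1)^{n+1} φ(a_{n+1} a₀, a₁,…,a_n)`. -/
def hochschildB (n : ℕ) : Cochain A n →ₗ[ℂ] Cochain A (n + 1) where
  toFun φ := (∑ j : Fin (n + 1),
      (-1 : ℂ) ^ (j : ℕ) • compTuple φ (face j) (continuous_face j) (face_update j)) +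
    (-1 : ℂ) ^ (n + 1) • compTuple φ lastFace continuous_lastFace lastFace_update
  map_add' φ ψ := by
    ext a
    simp only [add_apply, sum_apply,
      smul_apply, compTuple_apply, smul_eq_mul, mul_add,
      Finset.sum_add_distrib]
    ring
  map_smul' c φ := by
    ext a
    simp only [add_apply, sum_apply,
      smul_apply, compTuple_apply, smul_eq_mul, mul_add,
      Finset.mul_sum, RingHom.id_apply, mul_left_comm]

theorem hochschildB_apply {n : ℕ} (φ : Cochain A n) (a : Fin (n + 2) → A) :
    hochschildB n φ a = (∑ j : Fin (n + 1), (-1 : ℂ) ^ (j : ℕ) * φ (face j a)) +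
      (-1 : ℂ) ^ (n + 1) * φ (lastFace a) := by
  simp only [hochschildB, LinearMap.coe_mk, AddHom.coe_mk, add_apply,
    sum_apply, smul_apply, compTuple_apply,
    smul_eq_mul]

/-- `C^n_λ(A)`: the cochains with `φ(a₀,…,a_n) = (-1)^n φ(a₁,…,a_n,a₀)`. -/
def cyclicCochains (A : Type*) [NonUnitalNormedRing A] [NormedSpace ℂ A] (n : ℕ) :
    Submodule ℂ (Cochain A n) where
  carrier := {φ | ∀ a : Fin (n + 1) → A, φ a = (-1 : ℂ) ^ n * φ (a ∘ finRotate (n + 1))}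
  add_mem' hφ hψ a := by
    rw [add_apply, add_apply, hφ a, hψ a,
      mul_add]
  zero_mem' a := by simp
  smul_mem' c φ hφ a := by
    rw [smul_apply, smul_apply, hφ a]
    simp only [smul_eq_mul]
    ring

variable (A) in
/-- Hochschild `n`-cocycles. -/
def hochschildZ (n : ℕ) : Submodule ℂ (Cochain A n) := LinearMap.ker (hochschildB n)

variable (A) in
/-- Hochschild `n`-coboundaries. -/
def hochschildCob : (n : ℕ) → Submodule ℂ (Cochain A n)
  | 0 => ⊥
  | n + 1 => LinearMap.range (hochschildB n)

variable (A) in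
/-- Cyclic `n`-cocycles. -/
def cyclicZ (n : ℕ) : Submodule ℂ (Cochain A n) := cyclicCochains A n ⊓ hochschildZ A n

variable (A) in
/-- Cyclic `n`-coboundaries: images under `b` of cyclic cochains. -/
def cyclicCob : (n : ℕ) → Submodule ℂ (Cochain A n)
  | 0 => ⊥
  | n + 1 => (cyclicCochains A n).map (hochschildB n)

instance instAddCommGroupCochains {A : Type*} [NonUnitalNormedRing A] [NormedSpace ℂ A] {n : ℕ}
    (Z : Submodule ℂ (Cochain A n)) : AddCommGroup Z := Z.addCommGroup

variable (A) in
/-- The Hochschild cohomology `HH^n(A)`. -/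
abbrev HH (n : ℕ) : Type _ :=
  hochschildZ A n ⧸ (hochschildCob A n).comap (hochschildZ A n).subtype

variable (A) in
/-- The cyclic cohomology `HC^n_λ(A)`. -/
abbrev HC (n : ℕ) : Type _ :=
  cyclicZ A n ⧸ (cyclicCob A n).comap (cyclicZ A n).subtype

/-- The class in `HH^n(A)` of a Hochschild cocycle. -/
def HH.mk {n : ℕ} (φ : hochschildZ A n) : HH A n := Submodule.Quotient.mk φ

/-- The class in `HC^n_λ(A)` of a cyclic cocycle. -/
def HC.mk {n : ℕ} (φ : cyclicZ A n) : HC A n := Submodule.Quotient.mk φ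

/-- Pullback of cochains, `(j^*φ)(a₀,…,a_n) = φ(j a₀,…,j a_n)`. -/
def pullback (j : A₀ →ₙₐ[ℂ] A) (hj : Continuous j) (n : ℕ) : Cochain A n →ₗ[ℂ] Cochain A₀ n where
  toFun φ := φ.compContinuousLinearMap fun _ =>
    (⟨(j : A₀ →ₗ[ℂ] A), hj⟩ : A₀ →L[ℂ] A)
  map_add' φ ψ := by ext; simp
  map_smul' c φ := by ext; simp

theorem pullback_apply (j : A₀ →ₙₐ[ℂ] A) (hj : Continuous j) {n : ℕ} (φ : Cochain A n)
    (a : Fin (n + 1) → A₀) : pullback j hj n φ a = φ (fun i => j (a i)) := rfl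

theorem pullback_hochschildB (j : A₀ →ₙₐ[ℂ] A) (hj : Continuous j) {n : ℕ} (φ : Cochain A n) :
    pullback j hj (n + 1) (hochschildB n φ) = hochschildB n (pullback j hj n φ) := by
  ext a
  simp only [pullback_apply, hochschildB_apply]
  have h1 : ∀ k : Fin (n + 1), face k (fun i => j (a i)) = fun i => j (face k a i) := by
    intro k; funext i; simp only [face]; split_ifs <;> simp
  have h2 : lastFace (fun i => j (a i)) = fun i => j (lastFace a i) := by
    funext i; simp only [lastFace]; split_ifs <;> simp
  simp [h1, h2]

theorem pullback_mem_cyclicCochains (j : A₀ →ₙₐ[ℂ] A) (hj : Continuous j) {n : ℕ}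
    {φ : Cochain A n} (h : φ ∈ cyclicCochains A n) :
    pullback j hj n φ ∈ cyclicCochains A₀ n := fun a => h fun i => j (a i)

theorem pullback_mem_hochschildZ (j : A₀ →ₙₐ[ℂ] A) (hj : Continuous j) {n : ℕ}
    {φ : Cochain A n} (h : φ ∈ hochschildZ A n) : pullback j hj n φ ∈ hochschildZ A₀ n := by
  rw [hochschildZ, LinearMap.mem_ker] at h ⊢
  rw [← pullback_hochschildB, h, map_zero]

theorem pullback_mem_hochschildCob (j : A₀ →ₙₐ[ℂ] A) (hj : Continuous j) {n : ℕ}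
    {φ : Cochain A n} (h : φ ∈ hochschildCob A n) : pullback j hj n φ ∈ hochschildCob A₀ n := by
  cases n with
  | zero =>
    obtain rfl : φ = 0 := h
    exact map_zero _
  | succ n =>
    obtain ⟨ψ, rfl⟩ := h
    exact ⟨pullback j hj n ψ, (pullback_hochschildB j hj ψ).symm⟩

theorem pullback_mem_cyclicCob (j : A₀ →ₙₐ[ℂ] A) (hj : Continuous j) {n : ℕ}
    {φ : Cochain A n} (h : φ ∈ cyclicCob A n) : pullback j hj n φ ∈ cyclicCob A₀ n := by
  cases n with
  | zero =>
    obtain rfl : φ = 0 := h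
    exact map_zero _
  | succ n =>
    obtain ⟨ψ, hψ, rfl⟩ := h
    exact ⟨pullback j hj n ψ, pullback_mem_cyclicCochains j hj hψ,
      (pullback_hochschildB j hj ψ).symm⟩

/-- `j^* : HH^n(A) → HH^n(A₀)`. -/
def HH.map (j : A₀ →ₙₐ[ℂ] A) (hj : Continuous j) (n : ℕ) : HH A n →ₗ[ℂ] HH A₀ n :=
  Submodule.mapQ _ _
    ((pullback j hj n).restrict fun _ h => pullback_mem_hochschildZ j hj h)
    fun _ h => pullback_mem_hochschildCob j hj h

/-- `j^* : HC^n_λ(A) → HC^n_λ(A₀)`. -/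
def HC.map (j : A₀ →ₙₐ[ℂ] A) (hj : Continuous j) (n : ℕ) : HC A n →ₗ[ℂ] HC A₀ n :=
  Submodule.mapQ _ _
    ((pullback j hj n).restrict fun _ h =>
      ⟨pullback_mem_cyclicCochains j hj h.1, pullback_mem_hochschildZ j hj h.2⟩)
    fun _ h => pullback_mem_cyclicCob j hj h

end Cohomology

/-! ### Weak Schatten classes and Dixmier traces -/

section Operators

variable {H : Type*} [NormedAddCommGroup H] [InnerProductSpace ℂ H]

/-- Finite rank operators. -/
def IsFiniteRank (T : H →L[ℂ] H) : Prop := FiniteDimensional ℂ T.range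

/-- The `k`-th singular value `μ_k(T)`, `k = 0, 1, …`, as the distance from `T` to the operators
of rank at most `k`. -/
def singularValue (k : ℕ) (T : H →L[ℂ] H) : ℝ :=
  sInf {r | ∃ R : H →L[ℂ] H, IsFiniteRank R ∧ Module.finrank ℂ R.range ≤ k ∧ r = ‖T - R‖}

/-- `T ∈ 𝓛^{q,∞}(H)`. -/
def IsWeakSchatten (q : ℝ) (T : H →L[ℂ] H) : Prop :=
  IsCompactOperator T ∧
    (fun k : ℕ => singularValue k T) =O[atTop] fun k : ℕ => (k : ℝ) ^ (-1 / q)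

/-- The quasi-norm `sup_k (k+1)^{1/q} μ_k(T)` of `𝓛^{q,∞}(H)`. -/
def weakSchattenNorm (q : ℝ) (T : H →L[ℂ] H) : ℝ≥0∞ :=
  ⨆ k : ℕ, ENNReal.ofReal (((k : ℝ) + 1) ^ (1 / q) * singularValue k T)

/-- `T ∈ 𝓛₀^{q,∞}(H)`, the closure of the finite rank operators in `𝓛^{q,∞}(H)`. -/
def IsWeakSchattenZero (q : ℝ) (T : H →L[ℂ] H) : Prop :=
  IsWeakSchatten q T ∧
    ∀ ε : ℝ≥0∞, 0 < ε → ∃ R : H →L[ℂ] H, IsFiniteRank R ∧ weakSchattenNorm q (T - R) < ε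

/-- An extended limit: a state on `ℓ^∞(ℕ)` that annihilates `c₀(ℕ)`. -/
structure ExtendedLimit where
  /-- the underlying functional -/
  toFun : lp (fun _ : ℕ => ℂ) ∞ →L[ℂ] ℂ
  map_one : toFun 1 = 1
  nonneg : ∀ x : lp (fun _ : ℕ => ℂ) ∞, (∀ n, 0 ≤ x n) → 0 ≤ toFun x
  vanish : ∀ x : lp (fun _ : ℕ => ℂ) ∞, Tendsto (fun n => x n) atTop (𝓝 0) → toFun x = 0

open Classical in
/-- The value of an extended limit at a sequence (zero if the sequence is unbounded). -/
def ExtendedLimit.lim (ω : ExtendedLimit) (x : ℕ → ℂ) : ℂ :=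
  if h : Memℓp (E := fun _ : ℕ => ℂ) x ∞ then ω.toFun ⟨x, h⟩ else 0

/-- The Dixmier trace of a positive `T ∈ 𝓛^{1,∞}(H)`:
`ω`-limit of `(log (2 + N))⁻¹ ∑_{k=0}^N μ_k(T)`. -/
def dixmierPos (ω : ExtendedLimit) (T : H →L[ℂ] H) : ℂ :=
  ω.lim fun N =>
    (((∑ k ∈ Finset.range (N + 1), singularValue k T) / Real.log (2 + N) : ℝ) : ℂ)

/-- The Dixmier trace `Tr_ω` on `𝓛^{1,∞}(H)`, extended from the positive operators along
`T = (Re T)⁺ - (Re T)⁻ + i (Im T)⁺ - i (Im T)⁻`. -/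
def dixmierTrace [CompleteSpace H] (ω : ExtendedLimit) (T : H →L[ℂ] H) : ℂ :=
  (dixmierPos ω (realPart T : H →L[ℂ] H)⁺ - dixmierPos ω (realPart T : H →L[ℂ] H)⁻) +
    Complex.I * (dixmierPos ω (imaginaryPart T : H →L[ℂ] H)⁺ -
      dixmierPos ω (imaginaryPart T : H →L[ℂ] H)⁻)

/-- `STr_ω(T) = Tr_ω(γ T)` for the grading operator `γ`; `γ = 1` when `H` is ungraded. -/
def superDixmierTrace [CompleteSpace H] (ω : ExtendedLimit) (γ T : H →L[ℂ] H) : ℂ :=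
  dixmierTrace ω (γ * T)

end Operators

/-! ### Fredholm modules -/

/-- `π(A) ∪ π(A)^*`. -/
def opSet {A : Type*} [NonUnitalNormedRing A] [NormedSpace ℂ A]
    {H : Type*} [NormedAddCommGroup H] [InnerProductSpace ℂ H] [CompleteSpace H]
    (π : A →ₙₐ[ℂ] (H →L[ℂ] H)) : Set (H →L[ℂ] H) :=
  {b | ∃ a : A, b = π a ∨ b = star (π a)}

/-- A bounded Fredholm module `(π, H, F)` on `A`. -/
structure FredholmModule (A : Type*) [NonUnitalNormedRing A] [NormedSpace ℂ A]
    (H : Type*) [NormedAddCommGroup H] [InnerProductSpace ℂ H] [CompleteSpace H] where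
  /-- the representation -/
  π : A →ₙₐ[ℂ] (H →L[ℂ] H)
  continuous_π : Continuous π
  /-- the operator -/
  F : H →L[ℂ] H
  compact_comm : ∀ b ∈ opSet π, IsCompactOperator (⁅F, b⁆ : H →L[ℂ] H)
  compact_selfAdjoint : ∀ b ∈ opSet π, IsCompactOperator (b * (star F - F) : H →L[ℂ] H)
  compact_sq : ∀ b ∈ opSet π, IsCompactOperator (b * (F ^ 2 - 1) : H →L[ℂ] H)

namespace FredholmModule

variable {A : Type*} [NonUnitalNormedRing A] [NormedSpace ℂ A]
  {H : Type*} [NormedAddCommGroup H] [InnerProductSpace ℂ H] [CompleteSpace H]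

/-- Strictness: `b (F^* - F) = b (F² - 1) = 0` for all `b ∈ π(A) ∪ π(A)^*`. -/
def IsStrict (M : FredholmModule A H) : Prop :=
  ∀ b ∈ opSet M.π, b * (star M.F - M.F) = 0 ∧ b * (M.F ^ 2 - 1) = 0

/-- `(q,∞)`-summability. -/
def IsWeaklySummable (M : FredholmModule A H) (q : ℝ) : Prop :=
  ∀ b ∈ opSet M.π, IsWeakSchatten q ⁅M.F, b⁆ ∧ IsWeakSchatten (q / 2) (b * (star M.F - M.F)) ∧
      IsWeakSchatten (q / 2) (b * (M.F ^ 2 - 1))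

/-- The module has the parity of `p` and `γ` is its grading operator. For `p` even, `γ` is the
operator `±1` on the even/odd part of the `ℤ/2`-graded space `H`, `F` is odd and `A` acts by even
operators. For `p` odd, `H` is ungraded, which is encoded by `γ = 1`. -/
structure HasParity (M : FredholmModule A H) (p : ℕ) (γ : H →L[ℂ] H) : Prop where
  star_eq : star γ = γ
  sq_eq : γ ^ 2 = 1
  odd_F : Even p → γ * M.F = -(M.F * γ)
  even_π : ∀ a, γ * M.π a = M.π a * γ
  ungraded : Odd p → γ = 1

/-- `𝔥_ω(a₀,…,a_{p+1}) = p STr_ω(F a₀ [F,a₁] ⋯ [F,a_{p+1}])`. -/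
def hochschildCochain (M : FredholmModule A H) (γ : H →L[ℂ] H) (ω : ExtendedLimit) (p : ℕ)
    (a : Fin (p + 2) → A) : ℂ :=
  p * superDixmierTrace ω γ
    (M.F * M.π (a 0) * (List.ofFn fun i : Fin (p + 1) => ⁅M.F, M.π (a i.succ)⁆).prod)

/-- `𝔠_ω(a₀,…,a_p) = STr_ω(F [F,a₀] ⋯ [F,a_p])`. -/
def cyclicCochain (M : FredholmModule A H) (γ : H →L[ℂ] H) (ω : ExtendedLimit) (p : ℕ)
    (a : Fin (p + 1) → A) : ℂ :=
  superDixmierTrace ω γ (M.F * (List.ofFn fun i : Fin (p + 1) => ⁅M.F, M.π (a i)⁆).prod)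

end FredholmModule

end SingChern

end

noncomputable section

/-! The cochains `𝔥_ω` and `𝔠_ω` already vanish identically on `𝔄₀`: they are Dixmier traces of
products containing `p + 1` commutators `[F, a]`. If one commutator lies in the closure of the
finite rank operators, the product is a finite rank operator plus an operator of arbitrarily small
`𝓛^{1,∞}` size, so its trace is `0` (`dixmierTrace_eq_zero_of_weakSchattenZero`). The work lies in
the properties of the Dixmier trace and in the cocycle identities on `𝔄`.

The Dixmier trace is handled through `Approx`: finite rank operators `f N` of rank `O(N)` with `‖T -
f N‖ = O(N^{-s})`. For `s = 1`, two such approximations of `T` have traces differing by rank times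
norm, which is `O(1)`, so `ω`-`lim tr (f N) / log (2 + N)` depends on `T` only. It equals `Tr_ω T`
(`Approx.dixmierTrace_eq`): for `T ≥ 0` there are positive approximants, obtained by truncating the
spectrum, and their traces are sums of singular values. Linearity and the trace property
(`Approx.dixmierTrace_mul_comm`) are then inherited from finite rank operators, and no inequality
for sums of singular values is needed.

The cocycle identities rest on the Leibniz rule for `[F, ·]`, which telescopes the Hochschild sums
(`sum_word_face`), and on two ways of moving factors under the trace. A further commutator
multiplied by an operator of order `1` has trace zero, so `π(a)` commutes with `F`; strictness makes
`F` anticommute with commutators as soon as some `π(a)` or `[F, a]` stands on the left. Boundedness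
of the cochains comes from a Baire category argument (`exists_uniform_approx`). -/

namespace SingChern

/-! ### The trace of finite rank operators -/

section FiniteTrace

/-- The trace of a linear map of finite rank, computed on its range. -/
def finTrace {V : Type*} [AddCommGroup V] [Module ℂ V] (f : V →ₗ[ℂ] V) : ℂ :=
  LinearMap.trace ℂ (LinearMap.range f) (f.rangeRestrict ∘ₗ (LinearMap.range f).subtype)

variable {V : Type*} [AddCommGroup V] [Module ℂ V]

/-- The restriction to `W` factors through the range of `f`, and `tr (AB) = tr (BA)` exchanges the
two spaces. This lets several maps be traced on one common subspace. -/
theorem trace_codRestrict_eq_finTrace (f : V →ₗ[ℂ] V) (W : Submodule ℂ V)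
    [FiniteDimensional ℂ W] (h : ∀ x, f x ∈ W) :
    LinearMap.trace ℂ W (f.codRestrict W h ∘ₗ W.subtype) = finTrace f := by
  have hle : LinearMap.range f ≤ W := by rintro _ ⟨x, rfl⟩; exact h x
  have : FiniteDimensional ℂ (LinearMap.range f) := Submodule.finiteDimensional_of_le hle
  have := LinearMap.trace_comp_comm' (R := ℂ) (f.rangeRestrict ∘ₗ W.subtype)
    (Submodule.inclusion hle)
  calc _ = LinearMap.trace ℂ W
        (Submodule.inclusion hle ∘ₗ (f.rangeRestrict ∘ₗ W.subtype)) := rfl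
    _ = _ := this
    _ = _ := rfl

theorem finTrace_add {f g : V →ₗ[ℂ] V} (hf : FiniteDimensional ℂ (LinearMap.range f))
    (hg : FiniteDimensional ℂ (LinearMap.range g)) :
    finTrace (f + g) = finTrace f + finTrace g := by
  have h1 : ∀ x, f x ∈ LinearMap.range f ⊔ LinearMap.range g := fun x =>
    Submodule.mem_sup_left ⟨x, rfl⟩
  have h2 : ∀ x, g x ∈ LinearMap.range f ⊔ LinearMap.range g := fun x =>
    Submodule.mem_sup_right ⟨x, rfl⟩
  rw [← trace_codRestrict_eq_finTrace (f + g) _ fun x => add_mem (h1 x) (h2 x),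
    ← trace_codRestrict_eq_finTrace f _ h1, ← trace_codRestrict_eq_finTrace g _ h2, ← map_add]
  rfl

theorem finTrace_smul {f : V →ₗ[ℂ] V} (hf : FiniteDimensional ℂ (LinearMap.range f)) (c : ℂ) :
    finTrace (c • f) = c * finTrace f := by
  have h1 : ∀ x, f x ∈ LinearMap.range f := fun x => ⟨x, rfl⟩
  rw [← trace_codRestrict_eq_finTrace (c • f) _ fun x => Submodule.smul_mem _ c (h1 x),
    ← trace_codRestrict_eq_finTrace f _ h1, ← smul_eq_mul, ← map_smul]
  rfl

/-- Evaluated on `range f` and on its image under `g`, the two sides are the traces of `AB` and `BA`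
between finite dimensional spaces; `g` may have infinite rank. -/
theorem finTrace_comp_comm {f g : V →ₗ[ℂ] V} (hf : FiniteDimensional ℂ (LinearMap.range f)) :
    finTrace (f ∘ₗ g) = finTrace (g ∘ₗ f) := by
  have h1 : ∀ x, (f ∘ₗ g) x ∈ LinearMap.range f := fun x => ⟨g x, rfl⟩
  have h2 : ∀ x, (g ∘ₗ f) x ∈ (LinearMap.range f).map g := fun x => ⟨f x, ⟨x, rfl⟩, rfl⟩
  rw [← trace_codRestrict_eq_finTrace _ _ h1, ← trace_codRestrict_eq_finTrace _ _ h2]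
  exact LinearMap.trace_comp_comm' (R := ℂ)
    (g.restrict (p := LinearMap.range f) (q := (LinearMap.range f).map g) fun x hx => ⟨x, hx, rfl⟩)
    (f.rangeRestrict ∘ₗ ((LinearMap.range f).map g).subtype)

end FiniteTrace

section FiniteRank

variable {H : Type*} [NormedAddCommGroup H] [InnerProductSpace ℂ H]

/-- Operators of rank at most `k`. -/
def RankLE (k : ℕ) (T : H →L[ℂ] H) : Prop :=
  IsFiniteRank T ∧ Module.finrank ℂ T.range ≤ k

theorem RankLE.of_range_le {k : ℕ} {T : H →L[ℂ] H} {W : Submodule ℂ H}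
    (hW : FiniteDimensional ℂ W) (h : T.range ≤ W) (hk : Module.finrank ℂ W ≤ k) : RankLE k T :=
  ⟨Submodule.finiteDimensional_of_le h, (Submodule.finrank_mono h).trans hk⟩

theorem RankLE.mono {k l : ℕ} {T : H →L[ℂ] H} (h : RankLE k T) (hkl : k ≤ l) : RankLE l T :=
  ⟨h.1, h.2.trans hkl⟩

theorem RankLE.zero (k : ℕ) : RankLE k (0 : H →L[ℂ] H) := by
  refine RankLE.of_range_le (W := ⊥) inferInstance ?_ (by simp)
  rintro _ ⟨x, rfl⟩
  simp

theorem RankLE.add {k l : ℕ} {S T : H →L[ℂ] H} (hS : RankLE k S) (hT : RankLE l T) :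
    RankLE (k + l) (S + T) := by
  have := hS.1
  have := hT.1
  unfold IsFiniteRank at *
  refine RankLE.of_range_le (W := S.range ⊔ T.range) inferInstance ?_
    ((Submodule.finrank_add_le_finrank_add_finrank _ _).trans (add_le_add hS.2 hT.2))
  rintro _ ⟨x, rfl⟩
  exact add_mem (Submodule.mem_sup_left ⟨x, rfl⟩) (Submodule.mem_sup_right ⟨x, rfl⟩)

theorem RankLE.smul {k : ℕ} {T : H →L[ℂ] H} (hT : RankLE k T) (c : ℂ) : RankLE k (c • T) := by
  refine RankLE.of_range_le hT.1 ?_ hT.2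
  rintro _ ⟨x, rfl⟩
  exact Submodule.smul_mem _ c ⟨x, rfl⟩

theorem RankLE.neg {k : ℕ} {T : H →L[ℂ] H} (hT : RankLE k T) : RankLE k (-T) := by
  simpa using hT.smul (-1)

theorem RankLE.sub {k l : ℕ} {S T : H →L[ℂ] H} (hS : RankLE k S) (hT : RankLE l T) :
    RankLE (k + l) (S - T) := by
  rw [sub_eq_add_neg]
  exact hS.add hT.neg

theorem RankLE.mul_right {k : ℕ} {T : H →L[ℂ] H} (hT : RankLE k T) (S : H →L[ℂ] H) :
    RankLE k (T * S) := by
  refine RankLE.of_range_le hT.1 ?_ hT.2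
  rintro _ ⟨x, rfl⟩
  exact ⟨S x, rfl⟩

theorem RankLE.mul_left {k : ℕ} {T : H →L[ℂ] H} (hT : RankLE k T) (S : H →L[ℂ] H) :
    RankLE k (S * T) := by
  have := hT.1
  unfold IsFiniteRank at this
  refine RankLE.of_range_le (W := T.range.map (S : H →ₗ[ℂ] H)) inferInstance ?_
    ((Submodule.finrank_map_le _ _).trans hT.2)
  rintro _ ⟨x, rfl⟩
  exact ⟨T x, ⟨x, rfl⟩, rfl⟩

theorem norm_finTrace_le {k : ℕ} {T : H →L[ℂ] H} (hT : RankLE k T) :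
    ‖finTrace (T : H →ₗ[ℂ] H)‖ ≤ k * ‖T‖ := by
  have := hT.1
  unfold IsFiniteRank at this
  let b := stdOrthonormalBasis ℂ (LinearMap.range (T : H →ₗ[ℂ] H))
  rw [finTrace, LinearMap.trace_eq_sum_inner _ b]
  refine (norm_sum_le _ _).trans ((Finset.sum_le_card_nsmul _ _ ‖T‖ fun i _ => ?_).trans ?_)
  · refine (norm_inner_le_norm _ _).trans ?_
    rw [b.norm_eq_one, one_mul]
    refine (T.le_opNorm (b i)).trans ?_
    have : ‖((b i : LinearMap.range (T : H →ₗ[ℂ] H)) : H)‖ = 1 := b.norm_eq_one i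
    rw [this, mul_one]
  · simp only [Finset.card_univ, Fintype.card_fin, nsmul_eq_mul]
    gcongr
    exact hT.2

theorem RankLE.adjoint [CompleteSpace H] {k : ℕ} {T : H →L[ℂ] H} (hT : RankLE k T) :
    RankLE k (star T) := by
  have := hT.1
  unfold IsFiniteRank at this
  refine RankLE.of_range_le (W := T.range.map (star T : H →L[ℂ] H).toLinearMap) inferInstance ?_
    ((Submodule.finrank_map_le _ _).trans hT.2)
  rintro _ ⟨x, rfl⟩
  -- `T^*` kills the orthogonal complement of the range of `T`, so `x` may be replaced by its
  -- projection.
  refine ⟨T.range.starProjection x, Submodule.starProjection_apply_mem _ _, ?_⟩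
  refine ext_inner_right ℂ fun y => ?_
  have h := Submodule.starProjection_inner_eq_zero (K := T.range) x (T y) ⟨y, rfl⟩
  simp only [ContinuousLinearMap.coe_coe, ContinuousLinearMap.star_eq_adjoint,
    ContinuousLinearMap.adjoint_inner_left]
  rw [inner_sub_left, sub_eq_zero] at h
  exact h.symm

end FiniteRank

/-! ### Singular values -/

section SingularValues

variable {H : Type*} [NormedAddCommGroup H] [InnerProductSpace ℂ H]

theorem bddBelow_norm_sub_rankLE (k : ℕ) (T : H →L[ℂ] H) :
    BddBelow {r | ∃ R : H →L[ℂ] H, IsFiniteRank R ∧ Module.finrank ℂ R.range ≤ k ∧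
      r = ‖T - R‖} :=
  ⟨0, by rintro _ ⟨R, -, -, rfl⟩; exact norm_nonneg _⟩

theorem singularValue_le {k : ℕ} (T : H →L[ℂ] H) {R : H →L[ℂ] H} (hR : RankLE k R) :
    singularValue k T ≤ ‖T - R‖ :=
  csInf_le (bddBelow_norm_sub_rankLE k T) ⟨R, hR.1, hR.2, rfl⟩

theorem exists_rankLE_norm_sub_lt {k : ℕ} {T : H →L[ℂ] H} {r : ℝ} (h : singularValue k T < r) :
    ∃ R : H →L[ℂ] H, RankLE k R ∧ ‖T - R‖ < r := by
  have hne : {r | ∃ R : H →L[ℂ] H, IsFiniteRank R ∧ Module.finrank ℂ R.range ≤ k ∧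
      r = ‖T - R‖}.Nonempty := ⟨_, 0, (RankLE.zero k).1, (RankLE.zero k).2, rfl⟩
  obtain ⟨_, ⟨R, h1, h2, rfl⟩, h3⟩ := exists_lt_of_csInf_lt hne h
  exact ⟨R, ⟨h1, h2⟩, h3⟩

theorem le_singularValue {k : ℕ} {T : H →L[ℂ] H} {r : ℝ}
    (h : ∀ R : H →L[ℂ] H, RankLE k R → r ≤ ‖T - R‖) : r ≤ singularValue k T := by
  by_contra! hlt
  obtain ⟨R, h1, h2⟩ := exists_rankLE_norm_sub_lt hlt
  exact absurd (h R h1) (not_le.2 h2)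

theorem singularValue_nonneg (k : ℕ) (T : H →L[ℂ] H) : 0 ≤ singularValue k T :=
  le_singularValue fun _ _ => norm_nonneg _

theorem singularValue_le_add_norm_sub (k : ℕ) (S T : H →L[ℂ] H) :
    singularValue k S ≤ singularValue k T + ‖S - T‖ := by
  refine le_of_forall_pos_lt_add fun ε hε => ?_
  obtain ⟨R, h1, h2⟩ := exists_rankLE_norm_sub_lt (lt_add_of_pos_right (singularValue k T) hε)
  have h3 := singularValue_le S h1
  have h4 : ‖S - R‖ ≤ ‖S - T‖ + ‖T - R‖ := by
    rw [← sub_add_sub_cancel S T R]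
    exact norm_add_le _ _
  linarith

theorem abs_singularValue_sub_le (k : ℕ) (S T : H →L[ℂ] H) :
    |singularValue k S - singularValue k T| ≤ ‖S - T‖ := by
  rw [abs_le]
  have h1 := singularValue_le_add_norm_sub k S T
  have h2 := singularValue_le_add_norm_sub k T S
  rw [norm_sub_rev] at h2
  constructor <;> linarith

theorem singularValue_eq_zero_of_rankLE {k : ℕ} {T : H →L[ℂ] H} (h : RankLE k T) :
    singularValue k T = 0 :=
  le_antisymm (by simpa using singularValue_le T h) (singularValue_nonneg k T)

theorem norm_sum_smul_sq_of_orthonormal {ι : Type*} [Fintype ι] {v : ι → H}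
    (hv : Orthonormal ℂ v) (c : ι → ℂ) : ‖∑ i, c i • v i‖ ^ 2 = ∑ i, ‖c i‖ ^ 2 := by
  have h := hv.inner_sum c c Finset.univ
  rw [inner_self_eq_norm_sq_to_K] at h
  have h2 : ∀ i, (starRingEnd ℂ) (c i) * c i = ((‖c i‖ ^ 2 : ℝ) : ℂ) := fun i => by
    rw [mul_comm, Complex.mul_conj, Complex.normSq_eq_norm_sq]
  simp only [h2] at h
  exact Complex.ofReal_injective (by simpa using h)

/-- The operator `∑ i, c i ⟪v i, ·⟫ v i`. -/
def diagOp {ι : Type*} [Fintype ι] (v : ι → H) (c : ι → ℝ) : H →L[ℂ] H :=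
  ∑ i, (c i : ℂ) • InnerProductSpace.rankOne ℂ (v i) (v i)

theorem diagOp_apply {ι : Type*} [Fintype ι] (v : ι → H) (c : ι → ℝ) (x : H) :
    diagOp v c x = ∑ i, ((c i : ℂ) * inner ℂ (v i) x) • v i := by
  simp [diagOp, mul_smul]

theorem norm_diagOp_le {ι : Type*} [Fintype ι] {v : ι → H} (hv : Orthonormal ℂ v) {c : ι → ℝ}
    {K : ℝ} (hK : 0 ≤ K) (hc : ∀ i, |c i| ≤ K) : ‖diagOp v c‖ ≤ K := by
  refine ContinuousLinearMap.opNorm_le_bound _ hK fun x => ?_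
  refine abs_le_of_sq_le_sq' ?_ (by positivity) |>.2
  rw [diagOp_apply, norm_sum_smul_sq_of_orthonormal hv, mul_pow]
  calc ∑ i, ‖(c i : ℂ) * inner ℂ (v i) x‖ ^ 2
      ≤ ∑ i, K ^ 2 * ‖(inner ℂ (v i) x : ℂ)‖ ^ 2 := by
        refine Finset.sum_le_sum fun i _ => ?_
        rw [norm_mul, mul_pow, Complex.norm_real, Real.norm_eq_abs]
        gcongr
        exact hc i
    _ = K ^ 2 * ∑ i, ‖(inner ℂ (v i) x : ℂ)‖ ^ 2 := (Finset.mul_sum _ _ _).symm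
    _ ≤ K ^ 2 * ‖x‖ ^ 2 := by
        gcongr
        exact hv.sum_inner_products_le x

theorem rankLE_diagOp {ι : Type*} [Fintype ι] (v : ι → H) (c : ι → ℝ)
    (s : Finset ι) (hs : ∀ i ∉ s, c i = 0) : RankLE s.card (diagOp v c) := by
  classical
  refine RankLE.of_range_le (W := Submodule.span ℂ (s.image v : Set H))
    (FiniteDimensional.span_finset ℂ _) ?_
    ((finrank_span_finset_le_card _).trans Finset.card_image_le)
  rintro _ ⟨x, rfl⟩
  simp only [ContinuousLinearMap.coe_coe, diagOp_apply]
  refine Submodule.sum_mem _ fun i _ => ?_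
  by_cases hi : i ∈ s
  · exact Submodule.smul_mem _ _ (Submodule.subset_span (by simpa using ⟨i, hi, rfl⟩))
  · simp [hs i hi]

/-- Cutting off the first `k` coefficients attains `c k`. Conversely, an `R` of rank at most `k`
kills a nonzero vector in the span of the first `k + 1` vectors, on which the diagonal operator is
bounded below by `c k`. -/
theorem singularValue_diagOp {n : ℕ} {v : Fin n → H} (hv : Orthonormal ℂ v) {c : Fin n → ℝ}
    (hc0 : ∀ i, 0 ≤ c i) (hc : Antitone c) (k : Fin n) :
    singularValue k (diagOp v c) = c k := by
  apply le_antisymm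
  · have hR : RankLE k (diagOp v fun i => if i < k then c i else 0) := by
      have := rankLE_diagOp v (fun i => if i < k then c i else 0) (Finset.Iio k) (by
        intro i hi; simp at hi; simp [not_lt.2 hi])
      simpa using this
    refine (singularValue_le _ hR).trans ?_
    have : diagOp v c - (diagOp v fun i => if i < k then c i else 0) =
        diagOp v fun i => if i < k then 0 else c i := by
      rw [diagOp, diagOp, diagOp, ← Finset.sum_sub_distrib]
      refine Finset.sum_congr rfl fun i _ => ?_
      split_ifs <;> simp
    rw [this]
    refine norm_diagOp_le hv (hc0 k) fun i => ?_
    split_ifs with h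
    · simpa using hc0 k
    · rw [abs_of_nonneg (hc0 i)]
      exact hc (not_lt.1 h)
  · refine le_singularValue fun R hR => ?_
    have hfd := hR.1
    unfold IsFiniteRank at hfd
    let u : Fin (k + 1) → H := fun i => v (Fin.castLE k.2 i)
    have hu : Orthonormal ℂ u := hv.comp _ (Fin.castLE_injective _)
    let L : (Fin (k + 1) → ℂ) →ₗ[ℂ] R.range :=
      (R : H →ₗ[ℂ] H).rangeRestrict ∘ₗ Fintype.linearCombination ℂ u
    have hL : LinearMap.ker L ≠ ⊥ := by
      refine LinearMap.ker_ne_bot_of_finrank_lt ?_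
      have := hR.2
      simp
      omega
    obtain ⟨d, hd, hd0⟩ := Submodule.exists_mem_ne_zero_of_ne_bot hL
    set x : H := ∑ i, d i • u i with hx
    have hRx : R x = 0 := by
      have := congrArg Subtype.val (LinearMap.mem_ker.1 hd)
      rw [hx, ← Fintype.linearCombination_apply ℂ u d]
      exact this
    have hxn : ‖x‖ ^ 2 = ∑ i, ‖d i‖ ^ 2 := norm_sum_smul_sq_of_orthonormal hu d
    have hx0 : 0 < ‖x‖ := by
      rw [norm_pos_iff]
      intro h0
      apply hd0
      rw [h0] at hxn
      ext i
      have h1 : ∑ i, ‖d i‖ ^ 2 = 0 := by rw [← hxn]; simp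
      rw [Finset.sum_eq_zero_iff_of_nonneg (fun i _ => by positivity)] at h1
      simpa using h1 i (Finset.mem_univ i)
    have hin : ∀ i, (inner ℂ (u i) x : ℂ) = d i := fun i => hu.inner_right_fintype d i
    have hlow : (c k * ‖x‖) ^ 2 ≤ ‖diagOp v c x‖ ^ 2 := by
      rw [diagOp_apply, norm_sum_smul_sq_of_orthonormal hv, mul_pow, hxn, Finset.mul_sum]
      calc ∑ i, c k ^ 2 * ‖d i‖ ^ 2
          ≤ ∑ i : Fin (k + 1), ‖(c (Fin.castLE k.2 i) : ℂ) *
              (inner ℂ (v (Fin.castLE k.2 i)) x : ℂ)‖ ^ 2 := by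
            refine Finset.sum_le_sum fun i _ => ?_
            rw [show (inner ℂ (v (Fin.castLE k.2 i)) x : ℂ) = d i from hin i, norm_mul, mul_pow,
              Complex.norm_real, Real.norm_of_nonneg (hc0 _)]
            have := hc0 k
            gcongr
            apply hc
            rw [Fin.le_def]
            simpa using Nat.lt_succ_iff.1 i.2
        _ ≤ _ := by
            refine (Finset.sum_map Finset.univ ⟨_, Fin.castLE_injective k.2⟩
              (fun i => ‖(c i : ℂ) * (inner ℂ (v i) x : ℂ)‖ ^ 2)).symm.trans_le ?_
            exact Finset.sum_le_sum_of_subset_of_nonneg (Finset.subset_univ _)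
              fun _ _ _ => by positivity
    have h2 : c k * ‖x‖ ≤ ‖diagOp v c x‖ :=
      le_of_sq_le_sq hlow (norm_nonneg _)
    have h3 : ‖diagOp v c x‖ ≤ ‖diagOp v c - R‖ * ‖x‖ := by
      have := (diagOp v c - R).le_opNorm x
      simpa [hRx] using this
    exact le_of_mul_le_mul_right (h2.trans h3) hx0

/-- The range of `g` is invariant, and the spectral theorem applies to `g` restricted to it;
`finTrace` is by definition the trace of this restriction. -/
theorem exists_eq_diagOp {g : H →L[ℂ] H} (hg : g.IsPositive) (hfin : IsFiniteRank g) :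
    ∃ (v : Fin (Module.finrank ℂ g.range) → H) (c : Fin (Module.finrank ℂ g.range) → ℝ),
      Orthonormal ℂ v ∧ (∀ i, 0 ≤ c i) ∧ Antitone c ∧ g = diagOp v c ∧
      finTrace (g : H →ₗ[ℂ] H) = ((∑ i, c i : ℝ) : ℂ) := by
  unfold IsFiniteRank at hfin
  let T : g.range →ₗ[ℂ] g.range := (g : H →ₗ[ℂ] H).rangeRestrict ∘ₗ g.range.subtype
  have hT : T.IsSymmetric := fun x y => hg.isSymmetric x y
  let b := hT.eigenvectorBasis rfl
  have hb : ∀ i, g (b i : H) = (hT.eigenvalues rfl i : ℂ) • (b i : H) := fun i =>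
    congrArg Subtype.val (hT.apply_eigenvectorBasis rfl i)
  have hv : Orthonormal ℂ fun i => (b i : H) :=
    b.orthonormal.comp_linearIsometry g.range.subtypeₗᵢ
  refine ⟨fun i => (b i : H), hT.eigenvalues rfl, hv, fun i => ?_, hT.eigenvalues_antitone rfl,
    ?_, hT.trace_eq_sum_eigenvalues rfl⟩
  · have h := hg.re_inner_nonneg_right (b i : H)
    rw [hb, inner_smul_right, inner_self_eq_norm_sq_to_K, hv.1 i] at h
    simpa using h
  · ext x
    rw [diagOp_apply]
    have h := congrArg Subtype.val (b.sum_repr' (⟨g x, x, rfl⟩ : g.range))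
    rw [AddSubmonoidClass.coe_finsetSum] at h
    refine h.symm.trans (Finset.sum_congr rfl fun i _ => ?_)
    rw [Submodule.coe_smul, Submodule.coe_inner]
    congr 1
    have := hg.isSymmetric (b i : H) x
    simp only [ContinuousLinearMap.coe_coe] at this
    rw [← this, hb, inner_smul_left, Complex.conj_ofReal]

theorem finTrace_eq_sum_singularValue {g : H →L[ℂ] H} (hg : g.IsPositive) {m : ℕ}
    (hm : RankLE m g) :
    finTrace (g : H →ₗ[ℂ] H) = ((∑ k ∈ Finset.range m, singularValue k g : ℝ) : ℂ) := by
  obtain ⟨v, c, hv, hc0, hc, hgd, htr⟩ := exists_eq_diagOp hg hm.1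
  rw [htr]
  congr 1
  rw [← Finset.sum_subset (Finset.range_subset_range.2 hm.2), Finset.sum_range]
  · refine Finset.sum_congr rfl fun i _ => ?_
    exact ((congrArg (singularValue i) hgd).trans (singularValue_diagOp hv hc0 hc i)).symm
  · intro k _ hk
    exact singularValue_eq_zero_of_rankLE ⟨hm.1, by simpa using hk⟩

end SingularValues

/-! ### Truncation of a self-adjoint operator -/

section Truncation

variable {H : Type*} [NormedAddCommGroup H] [InnerProductSpace ℂ H] [CompleteSpace H]

/-- `(X - ε)⁺`. -/
def truncation (ε : ℝ) (X : H →L[ℂ] H) : H →L[ℂ] H := cfc (fun x : ℝ => max (x - ε) 0) X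

theorem truncation_isPositive (ε : ℝ) (X : H →L[ℂ] H) : (truncation ε X).IsPositive := by
  rw [← ContinuousLinearMap.nonneg_iff_isPositive]
  exact cfc_nonneg fun x _ => le_max_right _ _

theorem norm_posPart_sub_truncation_le {ε : ℝ} (hε : 0 ≤ ε) {X : H →L[ℂ] H}
    (hX : IsSelfAdjoint X) : ‖X⁺ - truncation ε X‖ ≤ ε := by
  have h : X⁺ = cfc (fun x : ℝ => max x 0) X := by
    rw [CFC.posPart_def, cfcₙ_eq_cfc]; rfl
  rw [h, truncation, ← cfc_sub (fun x : ℝ => max x 0) (fun x : ℝ => max (x - ε) 0) X]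
  refine norm_cfc_le hε fun x _ => ?_
  rw [Real.norm_eq_abs, abs_le]
  constructor <;> rcases max_cases x 0 with h | h <;> rcases max_cases (x - ε) 0 with h' | h' <;>
    linarith

/-- As a quadratic form, `X` is bounded below by `ε` on the range of `(X - ε)⁺`; by functional
calculus this is a pointwise inequality of functions. -/
theorem truncation_mul_mul_truncation_ge {ε : ℝ} {X : H →L[ℂ] H} (hX : IsSelfAdjoint X) :
    ε • (truncation ε X * truncation ε X) ≤ truncation ε X * X * truncation ε X := by
  have hid : cfc (fun x : ℝ => x) X = X := cfc_id' ℝ X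
  have h1 : ε • (truncation ε X * truncation ε X) =
      cfc (fun x : ℝ => ε • (max (x - ε) 0 * max (x - ε) 0)) X := by
    rw [cfc_smul ε (fun x : ℝ => max (x - ε) 0 * max (x - ε) 0) X,
      cfc_mul (fun x : ℝ => max (x - ε) 0) (fun x : ℝ => max (x - ε) 0) X]
    rfl
  have h2 : truncation ε X * X * truncation ε X =
      cfc (fun x : ℝ => max (x - ε) 0 * x * max (x - ε) 0) X := by
    rw [cfc_mul (fun x : ℝ => max (x - ε) 0 * x) (fun x : ℝ => max (x - ε) 0) X,
      cfc_mul (fun x : ℝ => max (x - ε) 0) (fun x : ℝ => x) X, hid]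
    rfl
  rw [h1, h2]
  refine cfc_mono fun x _ => ?_
  rcases max_cases (x - ε) 0 with h | h
  · rw [h.1, smul_eq_mul]
    nlinarith [mul_nonneg h.2 (mul_nonneg h.2 h.2)]
  · simp [h.1]

/-- `f` is injective on the range of the truncation: if `v` lies there and `f v = 0`, then `ε ‖v‖² ≤
⟪v, X v⟫ = ⟪v, (X - f) v⟫ ≤ ‖X - f‖ ‖v‖²` with `‖X - f‖ < ε`. Thus an arbitrary approximant yields a
positive one of no larger rank. -/
theorem rankLE_truncation {ε : ℝ} {X f : H →L[ℂ] H} (hX : IsSelfAdjoint X) {k : ℕ}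
    (hf : RankLE k f) (h : ‖X - f‖ < ε) : RankLE k (truncation ε X) := by
  have hfd := hf.1
  unfold IsFiniteRank at hfd
  set g := truncation ε X with hg
  have hsym := (truncation_isPositive ε X).isSymmetric
  have key : ∀ v ∈ g.range, f v = 0 → v = 0 := by
    rintro _ ⟨u, rfl⟩ hfv
    simp only [ContinuousLinearMap.coe_coe] at hfv ⊢
    have h1 := (ContinuousLinearMap.le_def _ _).1
      (truncation_mul_mul_truncation_ge (ε := ε) hX) |>.re_inner_nonneg_right u
    simp only [sub_apply, ← hg] at h1
    rw [inner_sub_right, map_sub, sub_nonneg] at h1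
    have e1 : (inner ℂ u ((ε • (g * g)) u) : ℂ) = (ε : ℂ) * inner ℂ (g u) (g u) := by
      rw [show (ε • (g * g)) u = (ε : ℂ) • g (g u) by simp, inner_smul_right]
      congr 1
      exact (hsym u (g u)).symm
    have e2 : (inner ℂ u ((g * X * g) u) : ℂ) = inner ℂ (g u) ((X - f) (g u)) := by
      rw [sub_apply, hfv, sub_zero]
      exact (hsym u (X (g u))).symm
    rw [e1, e2, inner_self_eq_norm_sq_to_K] at h1
    have h2 : ε * ‖g u‖ ^ 2 ≤ ‖X - f‖ * ‖g u‖ ^ 2 := by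
      calc ε * ‖g u‖ ^ 2 = RCLike.re ((ε : ℂ) * ((‖g u‖ : ℂ)) ^ 2) := by
            norm_cast
        _ ≤ _ := h1
        _ ≤ ‖(inner ℂ (g u) ((X - f) (g u)) : ℂ)‖ := RCLike.re_le_norm _
        _ ≤ ‖g u‖ * (‖X - f‖ * ‖g u‖) :=
          (norm_inner_le_norm _ _).trans (by gcongr; exact (X - f).le_opNorm _)
        _ = _ := by ring
    by_contra hne
    have : 0 < ‖g u‖ ^ 2 := by positivity
    nlinarith
  let L : g.range →ₗ[ℂ] f.range := (f : H →ₗ[ℂ] H).rangeRestrict ∘ₗ g.range.subtype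
  have hL : Function.Injective L := by
    rw [← LinearMap.ker_eq_bot, LinearMap.ker_eq_bot']
    intro v hv
    exact Subtype.ext (key v v.2 (congrArg Subtype.val hv))
  exact ⟨Module.Finite.of_injective L hL, (LinearMap.finrank_le_finrank_of_injective hL).trans hf.2⟩

end Truncation

/-! ### Extended limits -/

section ExtendedLimit

theorem memℓp_infty_of_norm_le {x : ℕ → ℂ} {K : ℝ} (h : ∀ n, ‖x n‖ ≤ K) :
    Memℓp (E := fun _ : ℕ => ℂ) x ∞ :=
  memℓp_infty ⟨K, by rintro _ ⟨n, rfl⟩; exact h n⟩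

namespace ExtendedLimit

variable (ω : ExtendedLimit)

theorem lim_eq {x : ℕ → ℂ} (h : Memℓp (E := fun _ : ℕ => ℂ) x ∞) :
    ω.lim x = ω.toFun ⟨x, h⟩ := dif_pos h

theorem lim_add {x y : ℕ → ℂ} (hx : Memℓp (E := fun _ : ℕ => ℂ) x ∞)
    (hy : Memℓp (E := fun _ : ℕ => ℂ) y ∞) : ω.lim (x + y) = ω.lim x + ω.lim y := by
  rw [ω.lim_eq hx, ω.lim_eq hy, ω.lim_eq (hx.add hy), ← map_add]
  rfl

theorem lim_smul {x : ℕ → ℂ} (hx : Memℓp (E := fun _ : ℕ => ℂ) x ∞) (c : ℂ) :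
    ω.lim (c • x) = c * ω.lim x := by
  rw [ω.lim_eq hx, ω.lim_eq (hx.const_smul c), ← smul_eq_mul, ← map_smul]
  rfl

theorem lim_eq_zero {x : ℕ → ℂ} (h : Tendsto x atTop (𝓝 0)) : ω.lim x = 0 := by
  rw [lim]
  split_ifs with hx
  · exact ω.vanish _ h
  · rfl

theorem lim_congr {x y : ℕ → ℂ} (hx : Memℓp (E := fun _ : ℕ => ℂ) x ∞)
    (hy : Memℓp (E := fun _ : ℕ => ℂ) y ∞) (h : Tendsto (fun n => x n - y n) atTop (𝓝 0)) :
    ω.lim x = ω.lim y := by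
  rw [← sub_eq_zero, ω.lim_eq hx, ω.lim_eq hy, ← map_sub]
  exact ω.vanish _ h

theorem norm_lim_le {x : ℕ → ℂ} {K : ℝ} (h : ∀ n, ‖x n‖ ≤ K) : ‖ω.lim x‖ ≤ ‖ω.toFun‖ * K := by
  rw [ω.lim_eq (memℓp_infty_of_norm_le h)]
  refine (ω.toFun.le_opNorm _).trans ?_
  gcongr
  exact lp.norm_le_of_forall_le ((norm_nonneg _).trans (h 0)) h

end ExtendedLimit

theorem log_two_add_pos (N : ℕ) : 0 < Real.log (2 + N) :=
  Real.log_pos (by have : (0 : ℝ) ≤ N := N.cast_nonneg; linarith)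

theorem tendsto_div_log_zero {x : ℕ → ℂ} {K : ℝ} (h : ∀ n, ‖x n‖ ≤ K) :
    Tendsto (fun N : ℕ => x N / (Real.log (2 + N) : ℂ)) atTop (𝓝 0) := by
  have h1 : Tendsto (fun N : ℕ => Real.log (2 + N)) atTop atTop :=
    Real.tendsto_log_atTop.comp
      (tendsto_atTop_add_const_left _ _ tendsto_natCast_atTop_atTop)
  refine squeeze_zero_norm (fun N => ?_) (h1.const_div_atTop K)
  rw [norm_div, Complex.norm_real, Real.norm_of_nonneg (log_two_add_pos N).le]
  gcongr
  · exact (log_two_add_pos N).le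
  · exact h N

theorem natLog_two_add_one_le (N : ℕ) : (Nat.log 2 N + 1 : ℝ) ≤ 4 * Real.log (2 + N) := by
  have h2 : (0.6931471803 : ℝ) < Real.log 2 := Real.log_two_gt_d9
  have hN : (0 : ℝ) ≤ N := N.cast_nonneg
  have h3 : Real.log 2 ≤ Real.log (2 + N) := Real.log_le_log (by norm_num) (by linarith)
  have h4 : Nat.log 2 N * Real.log 2 ≤ Real.log (2 + N) := by
    rw [← Real.log_pow]
    refine Real.log_le_log (by positivity) ?_
    rcases Nat.eq_zero_or_pos N with rfl | h
    · norm_num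
    · have := Nat.pow_log_le_self 2 h.ne'
      have : ((2 ^ Nat.log 2 N : ℕ) : ℝ) ≤ N := by exact_mod_cast this
      push_cast at this
      linarith
  have h5 : (0 : ℝ) ≤ Nat.log 2 N := Nat.cast_nonneg _
  -- Since `1 / log 2 < 2`, each of the two summands on the left is at most `2 log (2 + N)`.
  nlinarith

/-- A sequence whose dyadic increments are bounded grows at most logarithmically. -/
theorem norm_le_mul_natLog {x : ℕ → ℂ} {K : ℝ} (hK : 0 ≤ K) (h0 : x 0 = 0)
    (h : ∀ n, ‖x n - x (n / 2)‖ ≤ K) (n : ℕ) : ‖x n‖ ≤ K * (Nat.log 2 n + 1) := by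
  induction n using Nat.strong_induction_on with
  | _ n ih =>
    have hx : ‖x n‖ ≤ ‖x (n / 2)‖ + K := by
      have := norm_add_le (x (n / 2)) (x n - x (n / 2))
      rw [add_sub_cancel] at this
      linarith [h n]
    rcases Nat.lt_or_ge n 2 with hn | hn
    · have : n / 2 = 0 := by omega
      rw [this, h0, norm_zero, zero_add] at hx
      refine hx.trans (le_mul_of_one_le_right hK ?_)
      simp
    · have h1 := ih (n / 2) (by omega)
      rw [Nat.log_of_one_lt_of_le one_lt_two hn]
      push_cast
      linarith

end ExtendedLimit

/-! ### Approximation by operators of finite rank -/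

section Approx

variable {H : Type*} [NormedAddCommGroup H] [InnerProductSpace ℂ H]

/-- The operators `f N` have rank at most `C N` and distance at most `D (N + 1)^{-s}` to `T`. -/
structure Approx (s : ℝ) (C : ℕ) (D : ℝ) (T : H →L[ℂ] H) (f : ℕ → H →L[ℂ] H) : Prop where
  rank : ∀ N, RankLE (C * N) (f N)
  norm : ∀ N : ℕ, ‖T - f N‖ ≤ D * ((N : ℝ) + 1) ^ (-s)

namespace Approx

variable {s t : ℝ} {C C' : ℕ} {D D' : ℝ} {S T : H →L[ℂ] H} {f g : ℕ → H →L[ℂ] H}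

/-- The rank bound is `0` at `N = 0`; hence `D` bounds `‖T‖` and is nonnegative. -/
theorem apply_zero (h : Approx s C D T f) : f 0 = 0 := by
  have h1 := h.rank 0
  have := h1.1
  unfold IsFiniteRank at this
  have h2 := h1.2
  rw [mul_zero, Nat.le_zero, Submodule.finrank_eq_zero, LinearMap.range_eq_bot] at h2
  ext x
  exact LinearMap.congr_fun h2 x

theorem norm_le (h : Approx s C D T f) : ‖T‖ ≤ D := by
  simpa [h.apply_zero] using h.norm 0

theorem nonneg (h : Approx s C D T f) : 0 ≤ D := (norm_nonneg _).trans h.norm_le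

/-- Bounded operators have order `0`, so multiplication by them is a special case of `Approx.mul`.
-/
theorem of_norm_le (h : ‖T‖ ≤ D) : Approx 0 0 D T fun _ => 0 :=
  ⟨fun _ => RankLE.zero _, fun N => by simpa using h⟩

theorem mono (h : Approx s C D T f) (hC : C ≤ C') (hD : D ≤ D') : Approx s C' D' T f :=
  ⟨fun N => (h.rank N).mono (by gcongr), fun N => (h.norm N).trans (by gcongr)⟩

theorem add (hS : Approx s C D S f) (hT : Approx s C' D' T g) :
    Approx s (C + C') (D + D') (S + T) fun N => f N + g N where
  rank N := by
    rw [add_mul]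
    exact (hS.rank N).add (hT.rank N)
  norm N := by
    rw [add_sub_add_comm, add_mul]
    exact (norm_add_le _ _).trans (add_le_add (hS.norm N) (hT.norm N))

theorem smul (h : Approx s C D T f) (c : ℂ) : Approx s C (‖c‖ * D) (c • T) fun N => c • f N where
  rank N := (h.rank N).smul c
  norm N := by
    rw [← smul_sub, norm_smul, mul_assoc]
    gcongr
    exact h.norm N

theorem sub (hS : Approx s C D S f) (hT : Approx s C' D' T g) :
    Approx s (C + C') (D + D') (S - T) fun N => f N - g N := by
  simpa [sub_eq_add_neg] using hS.add (hT.smul (-1))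

/-- The approximant is `ST - (S - f)(T - g)`: its error is a product of errors, so the orders add,
while each of its terms contains a finite rank factor. -/
theorem mul (hS : Approx s C D S f) (hT : Approx t C' D' T g) :
    Approx (s + t) (C + C') (D * D') (S * T) fun N => f N * T + (S - f N) * g N where
  rank N := by
    rw [add_mul]
    exact ((hS.rank N).mul_right _).add ((hT.rank N).mul_left _)
  norm N := by
    have h1 : S * T - (f N * T + (S - f N) * g N) = (S - f N) * (T - g N) := by noncomm_ring
    have hD := hS.nonneg
    rw [h1, neg_add, Real.rpow_add (by positivity)]
    refine (norm_mul_le _ _).trans ((mul_le_mul (hS.norm N) (hT.norm N) (norm_nonneg _)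
      (by positivity)).trans_eq ?_)
    ring

theorem adjoint [CompleteSpace H] (h : Approx s C D T f) :
    Approx s C D (star T) fun N => star (f N) where
  rank N := (h.rank N).adjoint
  norm N := by
    rw [← star_sub, norm_star]
    exact h.norm N

/-- The infimum defining `μ_k` need not be attained, hence the slack `c < c'`. -/
theorem of_singularValue_le {c : ℝ} (h : ∀ k : ℕ, singularValue k T ≤ c * ((k : ℝ) + 1) ^ (-s))
    {c' : ℝ} (hc : c < c') : ∃ f, Approx s 1 c' T f := by
  have : ∀ N : ℕ, ∃ R : H →L[ℂ] H, RankLE N R ∧ ‖T - R‖ < c' * ((N : ℝ) + 1) ^ (-s) := fun N =>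
    exists_rankLE_norm_sub_lt ((h N).trans_lt (by gcongr))
  choose f h1 h2 using this
  exact ⟨f, fun N => by simpa using h1 N, fun N => (h2 N).le⟩

theorem singularValue_le (h : Approx s C D T f) (N : ℕ) {k : ℕ} (hk : C * N ≤ k) :
    singularValue k T ≤ D * ((N : ℝ) + 1) ^ (-s) :=
  (SingChern.singularValue_le T ((h.rank N).mono hk)).trans (h.norm N)

/-- The rank `O(N)` of `f N - g N` cancels against its norm `O(1/N)`. After division by `log (2 +
N)` the choice of approximation is irrelevant. -/
theorem norm_finTrace_sub_le (hf : Approx 1 C D T f) (hg : Approx 1 C' D' T g) (N : ℕ) :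
    ‖finTrace (f N : H →ₗ[ℂ] H) - finTrace (g N : H →ₗ[ℂ] H)‖ ≤ (C + C') * (D + D') := by
  have hfg : RankLE (C * N + C' * N) (f N - g N) := (hf.rank N).sub (hg.rank N)
  have h1 : finTrace (f N : H →ₗ[ℂ] H) - finTrace (g N : H →ₗ[ℂ] H) =
      finTrace ((f N - g N : H →L[ℂ] H) : H →ₗ[ℂ] H) := by
    have := finTrace_add (f := ((f N - g N : H →L[ℂ] H) : H →ₗ[ℂ] H)) (g := (g N : H →ₗ[ℂ] H))
      hfg.1 (hg.rank N).1
    rw [← ContinuousLinearMap.toLinearMap_add, sub_add_cancel] at this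
    rw [this, add_sub_cancel_right]
  have h2 : ‖f N - g N‖ ≤ (D + D') * ((N : ℝ) + 1)⁻¹ := by
    have h3 := hf.norm N
    have h4 := hg.norm N
    rw [Real.rpow_neg_one] at h3 h4
    rw [← sub_sub_sub_cancel_left _ _ T, add_mul]
    exact (norm_sub_le _ _).trans (by linarith)
  have hD := hf.nonneg
  have hD' := hg.nonneg
  rw [h1]
  calc _ ≤ ((C * N + C' * N : ℕ) : ℝ) * ‖f N - g N‖ := norm_finTrace_le hfg
    _ ≤ ((C + C') * (N + 1)) * ((D + D') * ((N : ℝ) + 1)⁻¹) := by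
      push_cast
      rw [← add_mul]
      gcongr
      linarith
    _ = _ := by field_simp

/-- Comparing `f N` with `f (N / 2)` bounds the dyadic increments of the traces, which therefore
grow at most logarithmically. -/
theorem half (hf : Approx 1 C D T f) : Approx 1 C (2 * D) T fun N => f (N / 2) where
  rank N := (hf.rank _).mono (by gcongr; exact Nat.div_le_self _ _)
  norm N := by
    refine (hf.norm _).trans ?_
    have hD := hf.nonneg
    have h1 : (N : ℝ) + 1 ≤ 2 * (((N / 2 : ℕ) : ℝ) + 1) := by
      norm_cast
      omega
    rw [Real.rpow_neg_one, Real.rpow_neg_one, mul_comm 2 D, mul_assoc]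
    gcongr
    rw [← div_eq_mul_inv, le_div_iff₀ (by positivity), inv_mul_le_iff₀ (by positivity)]
    linarith

/-- The normalised traces `tr (f N) / log (2 + N)`. -/
def _root_.SingChern.logTrace (f : ℕ → H →L[ℂ] H) (N : ℕ) : ℂ :=
  finTrace (f N : H →ₗ[ℂ] H) / (Real.log (2 + N) : ℂ)

theorem norm_logTrace_le (hf : Approx 1 C D T f) (N : ℕ) : ‖logTrace f N‖ ≤ 24 * C * D := by
  have hD := hf.nonneg
  have h1 : ‖finTrace (f N : H →ₗ[ℂ] H)‖ ≤ (6 * C * D) * (Nat.log 2 N + 1) := by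
    refine norm_le_mul_natLog (x := fun N => finTrace (f N : H →ₗ[ℂ] H)) (by positivity) ?_
      -- `(C + C)(D + 2D) = 6CD`; the factor `4` of `natLog_two_add_one_le` then gives `24`.
      (fun n => (hf.norm_finTrace_sub_le hf.half n).trans_eq (by ring)) N
    have := norm_finTrace_le (hf.rank 0)
    simpa using this
  rw [logTrace, norm_div, Complex.norm_real, Real.norm_of_nonneg (log_two_add_pos N).le,
    div_le_iff₀ (log_two_add_pos N)]
  calc _ ≤ _ := h1
    _ ≤ (6 * C * D) * (4 * Real.log (2 + N)) := by
      gcongr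
      exact natLog_two_add_one_le N
    _ = _ := by ring

theorem memℓp_logTrace (hf : Approx 1 C D T f) :
    Memℓp (E := fun _ : ℕ => ℂ) (logTrace f) ∞ :=
  memℓp_infty_of_norm_le hf.norm_logTrace_le

theorem lim_logTrace_eq (ω : ExtendedLimit) (hf : Approx 1 C D T f) (hg : Approx 1 C' D' T g) :
    ω.lim (logTrace f) = ω.lim (logTrace g) := by
  refine ω.lim_congr hf.memℓp_logTrace hg.memℓp_logTrace ?_
  have := tendsto_div_log_zero (hf.norm_finTrace_sub_le hg)
  simpa only [sub_div, logTrace] using this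

theorem logTrace_add (hf : Approx 1 C D S f) (hg : Approx 1 C' D' T g) :
    (logTrace fun N => f N + g N) = logTrace f + logTrace g := by
  funext N
  simp only [logTrace, Pi.add_apply]
  rw [ContinuousLinearMap.toLinearMap_add, finTrace_add (hf.rank N).1 (hg.rank N).1, add_div]

theorem logTrace_smul (hf : Approx 1 C D S f) (c : ℂ) :
    (logTrace fun N => c • f N) = c • logTrace f := by
  funext N
  simp only [logTrace, Pi.smul_apply, smul_eq_mul]
  rw [ContinuousLinearMap.toLinearMap_smul, finTrace_smul (hf.rank N).1, mul_div_assoc]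

/-- The trace of `f N` is the sum of its first `(C + 1)(N + 1)` singular values. The first `N + 1`
of them differ from those of `T` by at most `D / (N + 1)` each, and each of the remaining ones is
`O(1/N)`. -/
theorem norm_finTrace_sub_sum_singularValue_le (hf : Approx 1 C D T f)
    (hpos : ∀ N, (f N).IsPositive) (N : ℕ) :
    ‖finTrace (f N : H →ₗ[ℂ] H) -
      ((∑ k ∈ Finset.range (N + 1), singularValue k T : ℝ) : ℂ)‖ ≤
      D + (C + 1) * (D + D * (C + 1)) := by
  have hD := hf.nonneg
  have hle : N + 1 ≤ (C + 1) * (N + 1) := by nlinarith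
  rw [finTrace_eq_sum_singularValue (hpos N)
    ((hf.rank N).mono (show C * N ≤ (C + 1) * (N + 1) by nlinarith)), ← Complex.ofReal_sub,
    Complex.norm_real, Real.norm_eq_abs, ← Finset.sum_range_add_sum_Ico _ hle,
    add_sub_right_comm, ← Finset.sum_sub_distrib]
  have hdist : ∀ k, |singularValue k (f N) - singularValue k T| ≤ D * ((N : ℝ) + 1)⁻¹ := by
    intro k
    have := hf.norm N
    rw [Real.rpow_neg_one, norm_sub_rev] at this
    exact (abs_singularValue_sub_le k _ _).trans this
  refine (abs_add_le _ _).trans (add_le_add ?_ ?_)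
  · refine (Finset.abs_sum_le_sum_abs _ _).trans
      ((Finset.sum_le_card_nsmul _ _ _ fun k _ => hdist k).trans_eq ?_)
    simp only [Finset.card_range, nsmul_eq_mul]
    push_cast
    field_simp
  · refine (Finset.abs_sum_le_sum_abs _ _).trans
      ((Finset.sum_le_card_nsmul _ _ ((D + D * (C + 1)) * ((N : ℝ) + 1)⁻¹) fun k hk => ?_).trans ?_)
    · rw [abs_of_nonneg (singularValue_nonneg _ _)]
      have h1 := (abs_le.1 (hdist k)).2
      -- Here `μ_k(T)` is estimated by the approximant of index `k / (C + 1)`; dividing by `C + 1`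
      -- also covers `C = 0`.
      have hk' : C * (k / (C + 1)) ≤ k :=
        (Nat.mul_le_mul_right _ (Nat.le_succ C)).trans (Nat.mul_div_le k (C + 1))
      have h2 := hf.singularValue_le (k / (C + 1)) hk'
      rw [Real.rpow_neg_one] at h2
      have h3 : (N : ℝ) + 1 ≤ (C + 1) * (((k / (C + 1) : ℕ) : ℝ) + 1) := by
        have h4 : N + 1 ≤ k := (Finset.mem_Ico.1 hk).1
        have h5 : k ≤ (C + 1) * (k / (C + 1) + 1) := by
          have := Nat.div_add_mod k (C + 1)
          have := Nat.mod_lt k (show 0 < C + 1 by omega)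
          rw [mul_add]
          omega
        exact_mod_cast h4.trans h5
      have h6 : ((((k / (C + 1) : ℕ) : ℝ) + 1))⁻¹ ≤ (C + 1) * ((N : ℝ) + 1)⁻¹ := by
        rw [← div_eq_mul_inv, le_div_iff₀ (by positivity), inv_mul_le_iff₀ (by positivity)]
        linarith
      have h7 := mul_le_mul_of_nonneg_left h6 hD
      rw [add_mul]
      linarith
    · rw [Nat.card_Ico, nsmul_eq_mul]
      have : (((C + 1) * (N + 1) - (N + 1) : ℕ) : ℝ) ≤ (C + 1) * (N + 1) := by
        exact_mod_cast Nat.sub_le _ _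
      calc _ ≤ ((C + 1) * ((N : ℝ) + 1)) * ((D + D * (C + 1)) * ((N : ℝ) + 1)⁻¹) := by
            gcongr
        _ = _ := by field_simp

theorem dixmierPos_eq (ω : ExtendedLimit) (hf : Approx 1 C D T f)
    (hpos : ∀ N, (f N).IsPositive) : dixmierPos ω T = ω.lim (logTrace f) := by
  have hb := hf.norm_finTrace_sub_sum_singularValue_le hpos
  have hs : (fun N => (((∑ k ∈ Finset.range (N + 1), singularValue k T) /
      Real.log (2 + N) : ℝ) : ℂ)) = fun N => logTrace f N - (finTrace (f N : H →ₗ[ℂ] H) -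
        ((∑ k ∈ Finset.range (N + 1), singularValue k T : ℝ) : ℂ)) / (Real.log (2 + N) : ℂ) := by
    funext N
    rw [logTrace, ← sub_div, sub_sub_cancel, Complex.ofReal_div]
  have ht := tendsto_div_log_zero hb
  -- Boundedness matters because `ExtendedLimit.lim` takes the default value `0` on unbounded
  -- sequences.
  obtain ⟨K, hK⟩ := ht.norm.bddAbove_range
  rw [dixmierPos, hs]
  refine ω.lim_congr ?_ hf.memℓp_logTrace ?_
  · exact hf.memℓp_logTrace.sub (memℓp_infty_of_norm_le fun n => hK ⟨n, rfl⟩)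
  · simpa using ht.neg

theorem exists_of_isFiniteRank (s : ℝ) (hT : IsFiniteRank T) :
    ∃ C D, Approx s C D T fun N => if N = 0 then 0 else T := by
  refine ⟨Module.finrank ℂ T.range, ‖T‖, fun N => ?_, fun N => ?_⟩
  · split_ifs with h
    · exact RankLE.zero _
    · exact ⟨hT, Nat.le_mul_of_pos_right _ (Nat.pos_of_ne_zero h)⟩
  · split_ifs with h
    · simp [h]
    · simp only [sub_self, norm_zero]
      positivity

end Approx

end Approx

/-! ### The Dixmier trace -/

section Dixmier

variable {H : Type*} [NormedAddCommGroup H] [InnerProductSpace ℂ H] [CompleteSpace H]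

variable {s t : ℝ} {C C' : ℕ} {D D' : ℝ} {S T X : H →L[ℂ] H} {f g : ℕ → H →L[ℂ] H}

/-- The threshold uses `D + 1`, since `rankLE_truncation` needs it strictly above the error. -/
theorem Approx.posPart (hX : IsSelfAdjoint X) (h : Approx 1 C D X f) :
    Approx 1 C (D + 1) X⁺ fun N => truncation ((D + 1) * ((N : ℝ) + 1) ^ (-1 : ℝ)) X where
  rank N := rankLE_truncation hX (h.rank N) ((h.norm N).trans_lt (by gcongr; linarith))
  norm N := norm_posPart_sub_truncation_le
    (mul_nonneg (by linarith [h.nonneg]) (by positivity)) hX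

/-- `X⁺` and `X⁻ = (-X)⁺` have positive approximants whose difference approximates `X`; by
independence of the approximation it may be replaced by `f`. -/
theorem Approx.dixmierPos_sub_eq (ω : ExtendedLimit) (hX : IsSelfAdjoint X)
    (h : Approx 1 C D X f) : dixmierPos ω X⁺ - dixmierPos ω X⁻ = ω.lim (logTrace f) := by
  have h1 := h.posPart hX
  have h2 := (h.smul (-1)).posPart (X := (-1 : ℂ) • X) (by simpa using hX.neg)
  rw [show ((-1 : ℂ) • X)⁺ = X⁻ by rw [neg_one_smul, CFC.posPart_neg]] at h2
  rw [h1.dixmierPos_eq ω fun N => truncation_isPositive _ _,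
    h2.dixmierPos_eq ω fun N => truncation_isPositive _ _]
  have h3 := h1.add (h2.smul (-1))
  rw [neg_one_smul, ← sub_eq_add_neg, CFC.posPart_sub_negPart X hX] at h3
  rw [h.lim_logTrace_eq ω h3, Approx.logTrace_add h1 (h2.smul (-1)), h2.logTrace_smul,
    ω.lim_add h1.memℓp_logTrace (h2.memℓp_logTrace.const_smul (-1)),
    ω.lim_smul h2.memℓp_logTrace]
  ring

/-- The Dixmier trace is computed by any approximation by operators of finite rank. -/
theorem Approx.dixmierTrace_eq (ω : ExtendedLimit) (h : Approx 1 C D T f) :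
    dixmierTrace ω T = ω.lim (logTrace f) := by
  have hre : ((realPart T : selfAdjoint (H →L[ℂ] H)) : H →L[ℂ] H) =
      (2⁻¹ : ℂ) • (T + star T) := by
    rw [realPart_apply_coe]
    norm_num [← Complex.coe_smul]
  have him : ((imaginaryPart T : selfAdjoint (H →L[ℂ] H)) : H →L[ℂ] H) =
      (-Complex.I) • (2⁻¹ : ℂ) • (T - star T) := by
    rw [imaginaryPart_apply_coe]
    norm_num [← Complex.coe_smul]
  have h1 := (h.add h.adjoint).smul 2⁻¹
  have h2 := ((h.sub h.adjoint).smul 2⁻¹).smul (-Complex.I)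
  rw [← hre] at h1
  rw [← him] at h2
  have h3 := h1.add (h2.smul Complex.I)
  rw [realPart_add_I_smul_imaginaryPart] at h3
  rw [dixmierTrace, h1.dixmierPos_sub_eq ω (realPart T).2,
    h2.dixmierPos_sub_eq ω (imaginaryPart T).2, h.lim_logTrace_eq ω h3,
    Approx.logTrace_add h1 (h2.smul Complex.I), h2.logTrace_smul,
    ω.lim_add h1.memℓp_logTrace (h2.memℓp_logTrace.const_smul _), ω.lim_smul h2.memℓp_logTrace]

theorem Approx.norm_dixmierTrace_le (ω : ExtendedLimit) (h : Approx 1 C D T f) :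
    ‖dixmierTrace ω T‖ ≤ ‖ω.toFun‖ * (24 * C * D) := by
  rw [h.dixmierTrace_eq ω]
  exact ω.norm_lim_le h.norm_logTrace_le

theorem Approx.dixmierTrace_add (ω : ExtendedLimit) (hS : Approx 1 C D S f)
    (hT : Approx 1 C' D' T g) :
    dixmierTrace ω (S + T) = dixmierTrace ω S + dixmierTrace ω T := by
  rw [(hS.add hT).dixmierTrace_eq ω, hS.dixmierTrace_eq ω, hT.dixmierTrace_eq ω,
    Approx.logTrace_add hS hT, ω.lim_add hS.memℓp_logTrace hT.memℓp_logTrace]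

theorem Approx.dixmierTrace_smul (ω : ExtendedLimit) (hT : Approx 1 C D T f) (c : ℂ) :
    dixmierTrace ω (c • T) = c * dixmierTrace ω T := by
  rw [(hT.smul c).dixmierTrace_eq ω, hT.dixmierTrace_eq ω, hT.logTrace_smul,
    ω.lim_smul hT.memℓp_logTrace]

/-- The approximants of `ST` and `TS` supplied by `Approx.mul` have equal traces for every `N`, once
their terms are regrouped so that each is a product with a finite rank factor. -/
theorem Approx.dixmierTrace_mul_comm (ω : ExtendedLimit) (hS : Approx s C D S f)
    (hT : Approx t C' D' T g) (hst : s + t = 1) :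
    dixmierTrace ω (S * T) = dixmierTrace ω (T * S) := by
  have h1 := hS.mul hT
  have h2 := hT.mul hS
  rw [hst] at h1
  rw [add_comm t s, hst] at h2
  rw [h1.dixmierTrace_eq ω, h2.dixmierTrace_eq ω]
  congr 1
  funext N
  simp only [logTrace]
  congr 1
  have hf := (hS.rank N).1
  have hg := (hT.rank N).1
  have e1 : f N * T + (S - f N) * g N = (f N * (T - g N)) + S * g N := by noncomm_ring
  have e2 : g N * S + (T - g N) * f N = (T - g N) * f N + g N * S := by noncomm_ring
  rw [e1, e2, ContinuousLinearMap.toLinearMap_add, ContinuousLinearMap.toLinearMap_add,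
    finTrace_add ((hS.rank N).mul_right _).1 ((hT.rank N).mul_left _).1,
    finTrace_add ((hS.rank N).mul_left _).1 ((hT.rank N).mul_right _).1]
  congr 1
  · exact finTrace_comp_comm (f := (f N : H →ₗ[ℂ] H)) (g := ((T - g N : H →L[ℂ] H) : H →ₗ[ℂ] H)) hf
  · exact (finTrace_comp_comm (f := (g N : H →ₗ[ℂ] H)) (g := (S : H →ₗ[ℂ] H)) hg).symm

theorem dixmierTrace_eq_zero_of_isFiniteRank (ω : ExtendedLimit) (hT : IsFiniteRank T) :
    dixmierTrace ω T = 0 := by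
  obtain ⟨C, D, h⟩ := Approx.exists_of_isFiniteRank 1 hT
  rw [h.dixmierTrace_eq ω]
  refine ω.lim_eq_zero (tendsto_div_log_zero (K := ‖finTrace (T : H →ₗ[ℂ] H)‖ +
    ‖finTrace ((0 : H →L[ℂ] H) : H →ₗ[ℂ] H)‖) fun N => ?_)
  dsimp only
  split_ifs <;> simp

/-- The Dixmier trace vanishes on operators that are, up to operators of finite rank, arbitrarily
small. -/
theorem dixmierTrace_eq_zero_of_approx (ω : ExtendedLimit) {K : ℝ}
    (h : ∀ ε : ℝ, 0 < ε → ∃ R E f, IsFiniteRank R ∧ Approx 1 C (K * ε) E f ∧ T = R + E) :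
    dixmierTrace ω T = 0 := by
  rw [← norm_le_zero_iff]
  have hlim : Tendsto (fun ε : ℝ => ‖ω.toFun‖ * (24 * C * (K * ε))) (𝓝[>] 0) (𝓝 0) := by
    have : Continuous fun ε : ℝ => ‖ω.toFun‖ * (24 * C * (K * ε)) := by fun_prop
    have := this.tendsto 0
    simp only [mul_zero] at this
    exact this.mono_left nhdsWithin_le_nhds
  refine ge_of_tendsto hlim (eventually_nhdsWithin_of_forall fun ε hε => ?_)
  obtain ⟨R, E, f, hR, hE, rfl⟩ := h ε hε
  obtain ⟨C', D', hR'⟩ := Approx.exists_of_isFiniteRank 1 hR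
  rw [hR'.dixmierTrace_add ω hE, dixmierTrace_eq_zero_of_isFiniteRank ω hR, zero_add]
  exact hE.norm_dixmierTrace_le ω

/-- The Dixmier trace vanishes on the products of an operator in `𝓛^{1,∞}` and an operator that is
approximated by operators of finite rank. -/
theorem Approx.dixmierTrace_mul_eq_zero (ω : ExtendedLimit) (hs : 0 < s) (hS : Approx s C D S f)
    (hT : Approx 1 C' D' T g) : dixmierTrace ω (S * T) = 0 := by
  refine dixmierTrace_eq_zero_of_approx ω (C := C') (K := D') fun ε hε => ?_
  have hlim : Tendsto (fun N : ℕ => D * ((N : ℝ) + 1) ^ (-s)) atTop (𝓝 0) := by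
    have h1 : Tendsto (fun N : ℕ => (N : ℝ) + 1) atTop atTop :=
      tendsto_atTop_add_const_right _ _ tendsto_natCast_atTop_atTop
    simpa using ((tendsto_rpow_neg_atTop hs).comp h1).const_mul D
  -- One fixed `N` suffices: `ST = f N * T + (S - f N) * T`, with `‖S - f N‖ < ε` in the second
  -- term.
  obtain ⟨N, hN⟩ := (hlim.eventually (gt_mem_nhds hε)).exists
  have h1 := (Approx.of_norm_le ((hS.norm N).trans hN.le)).mul hT
  rw [zero_add, zero_add, mul_comm ε D'] at h1
  exact ⟨f N * T, _, _, ((hS.rank N).mul_right T).1, h1, by noncomm_ring⟩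

end Dixmier

/-! ### Weak Schatten classes and approximation -/

section WeakSchatten

variable {H : Type*} [NormedAddCommGroup H] [InnerProductSpace ℂ H]

/-- The operators that admit approximations by operators of rank `O(N)` up to `O(N^{-s})`. -/
def IsApprox (s : ℝ) (T : H →L[ℂ] H) : Prop := ∃ C D f, Approx s C D T f

namespace IsApprox

variable {s t : ℝ} {S T : H →L[ℂ] H}

theorem of_bounded (T : H →L[ℂ] H) : IsApprox 0 T := ⟨_, _, _, Approx.of_norm_le le_rfl⟩

theorem add (hS : IsApprox s S) (hT : IsApprox s T) : IsApprox s (S + T) := by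
  obtain ⟨_, _, _, hS⟩ := hS
  obtain ⟨_, _, _, hT⟩ := hT
  exact ⟨_, _, _, hS.add hT⟩

theorem smul (hT : IsApprox s T) (c : ℂ) : IsApprox s (c • T) := by
  obtain ⟨_, _, _, hT⟩ := hT
  exact ⟨_, _, _, hT.smul c⟩

theorem mul (hS : IsApprox s S) (hT : IsApprox t T) : IsApprox (s + t) (S * T) := by
  obtain ⟨_, _, _, hS⟩ := hS
  obtain ⟨_, _, _, hT⟩ := hT
  exact ⟨_, _, _, hS.mul hT⟩

theorem bounded_mul (hT : IsApprox s T) (S : H →L[ℂ] H) : IsApprox s (S * T) := by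
  simpa using (of_bounded S).mul hT

theorem mul_bounded (hT : IsApprox s T) (S : H →L[ℂ] H) : IsApprox s (T * S) := by
  simpa using hT.mul (of_bounded S)

variable [CompleteSpace H] (ω : ExtendedLimit)

theorem dixmierTrace_add (hS : IsApprox 1 S) (hT : IsApprox 1 T) :
    dixmierTrace ω (S + T) = dixmierTrace ω S + dixmierTrace ω T := by
  obtain ⟨_, _, _, hS⟩ := hS
  obtain ⟨_, _, _, hT⟩ := hT
  exact hS.dixmierTrace_add ω hT

theorem dixmierTrace_smul (hT : IsApprox 1 T) (c : ℂ) :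
    dixmierTrace ω (c • T) = c * dixmierTrace ω T := by
  obtain ⟨_, _, _, hT⟩ := hT
  exact hT.dixmierTrace_smul ω c

theorem dixmierTrace_mul_comm (hS : IsApprox s S) (hT : IsApprox t T) (h : s + t = 1) :
    dixmierTrace ω (S * T) = dixmierTrace ω (T * S) := by
  obtain ⟨_, _, _, hS⟩ := hS
  obtain ⟨_, _, _, hT⟩ := hT
  exact hS.dixmierTrace_mul_comm ω hT h

theorem dixmierTrace_mul_eq_zero (hs : 0 < s) (hS : IsApprox s S) (hT : IsApprox 1 T) :
    dixmierTrace ω (S * T) = 0 := by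
  obtain ⟨_, _, _, hS⟩ := hS
  obtain ⟨_, _, _, hT⟩ := hT
  exact hS.dixmierTrace_mul_eq_zero ω hs hT

end IsApprox

/-- The operators of approximation order `1`, as a subspace. -/
def approxOne (H : Type*) [NormedAddCommGroup H] [InnerProductSpace ℂ H] :
    Submodule ℂ (H →L[ℂ] H) where
  carrier := {T | IsApprox 1 T}
  add_mem' := IsApprox.add
  zero_mem' := ⟨0, 0, fun _ => 0, fun _ => RankLE.zero _, fun _ => by simp⟩
  smul_mem' c _ hT := hT.smul c

/-- The Dixmier trace as a linear functional. -/
def dixmierLinear [CompleteSpace H] (ω : ExtendedLimit) : approxOne H →ₗ[ℂ] ℂ where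
  toFun T := dixmierTrace ω (T : H →L[ℂ] H)
  map_add' S T := IsApprox.dixmierTrace_add ω S.2 T.2
  map_smul' c T := IsApprox.dixmierTrace_smul ω T.2 c

theorem dixmierTrace_sum_smul [CompleteSpace H] (ω : ExtendedLimit) {ι : Type*} (u : Finset ι)
    (c : ι → ℂ) {T : ι → H →L[ℂ] H} (hT : ∀ i, IsApprox 1 (T i)) :
    dixmierTrace ω (∑ i ∈ u, c i • T i) = ∑ i ∈ u, c i * dixmierTrace ω (T i) := by
  have h := map_sum (dixmierLinear ω) (fun i => c i • (⟨T i, hT i⟩ : approxOne H)) u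
  simp only [map_smul, smul_eq_mul] at h
  rw [← show ((∑ i ∈ u, c i • (⟨T i, hT i⟩ : approxOne H) : approxOne H) : H →L[ℂ] H) =
    ∑ i ∈ u, c i • T i by simp]
  exact h

theorem IsWeakSchatten.exists_singularValue_le {q : ℝ} (hq : 0 < q) {T : H →L[ℂ] H}
    (hT : IsWeakSchatten q T) :
    ∃ c, ∀ k : ℕ, singularValue k T ≤ c * ((k : ℝ) + 1) ^ (-(1 / q)) := by
  have h1 : (fun k : ℕ => (k : ℝ) ^ (-1 / q)) =O[atTop]
      fun k : ℕ => ((k : ℝ) + 1) ^ (-(1 / q)) := by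
    -- The constant comes from `k + 1 ≤ 2k` for `k ≥ 1`.
    refine IsBigO.of_bound ((2 : ℝ) ^ (1 / q)) ?_
    filter_upwards [eventually_ge_atTop 1] with k hk
    have hk' : (1 : ℝ) ≤ k := by exact_mod_cast hk
    have h2 : (2 * (k : ℝ)) ^ (-(1 / q)) ≤ ((k : ℝ) + 1) ^ (-(1 / q)) :=
      Real.rpow_le_rpow_of_nonpos (by positivity) (by linarith)
        (neg_nonpos.2 (by positivity))
    rw [Real.norm_of_nonneg (by positivity), Real.norm_of_nonneg (by positivity), neg_div]
    refine le_trans ?_ (mul_le_mul_of_nonneg_left h2 (by positivity))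
    rw [Real.mul_rpow (by norm_num) (by positivity), ← mul_assoc,
      ← Real.rpow_add (by norm_num), add_neg_cancel, Real.rpow_zero, one_mul]
  obtain ⟨c, -, hc⟩ := bound_of_isBigO_nat_atTop (hT.2.trans h1)
  refine ⟨c, fun k => ?_⟩
  have h3 : (0 : ℝ) < ((k : ℝ) + 1) ^ (-(1 / q)) := by positivity
  have := hc (x := k) h3.ne'
  rwa [Real.norm_of_nonneg (singularValue_nonneg _ _), Real.norm_of_nonneg h3.le] at this

theorem IsWeakSchattenZero.exists_approx {q : ℝ} {T : H →L[ℂ] H} (hT : IsWeakSchattenZero q T)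
    {ε : ℝ} (hε : 0 < ε) :
    ∃ R f, IsFiniteRank R ∧ Approx (1 / q) 1 (2 * ε) (T - R) f := by
  obtain ⟨R, hR, hlt⟩ := hT.2 (ENNReal.ofReal ε) (by simpa using hε)
  have h1 : ∀ k : ℕ, singularValue k (T - R) ≤ ε * ((k : ℝ) + 1) ^ (-(1 / q)) := by
    intro k
    have h2 := (le_iSup (fun k : ℕ =>
      ENNReal.ofReal (((k : ℝ) + 1) ^ (1 / q) * singularValue k (T - R))) k).trans_lt hlt
    have h3 := ((ENNReal.ofReal_lt_ofReal_iff hε).1 h2).le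
    rw [Real.rpow_neg (by positivity), ← div_eq_mul_inv, le_div_iff₀ (by positivity)]
    linarith
  obtain ⟨f, hf⟩ := Approx.of_singularValue_le h1 (c' := 2 * ε) (by linarith)
  exact ⟨R, f, hR, hf⟩

/-- If `d` takes values in a weak Schatten class, it does so boundedly. -/
theorem exists_uniform_approx {A : Type*} [NormedAddCommGroup A] [NormedSpace ℂ A]
    [CompleteSpace A] (d : A →L[ℂ] H →L[ℂ] H) {s : ℝ}
    (hd : ∀ a, ∃ c, ∀ k : ℕ, singularValue k (d a) ≤ c * ((k : ℝ) + 1) ^ (-s)) :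
    ∃ K, 0 ≤ K ∧ ∀ a, ∃ f, Approx s 2 (K * ‖a‖) (d a) f := by
  -- Baire category: the `E n` are closed because `μ_k` is `1`-Lipschitz, and they cover `A`, so one
  -- contains a ball.
  let E : ℕ → Set A := fun n => {a | ∀ k : ℕ, singularValue k (d a) ≤ n * ((k : ℝ) + 1) ^ (-s)}
  have hcont : ∀ k, Continuous fun a => singularValue k (d a) := by
    intro k
    have h1 : LipschitzWith 1 fun T : H →L[ℂ] H => singularValue k T :=
      LipschitzWith.of_dist_le_mul fun S T => by
        rw [NNReal.coe_one, one_mul, Real.dist_eq, dist_eq_norm]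
        exact abs_singularValue_sub_le k S T
    exact h1.continuous.comp d.continuous
  have hE : ∀ n, IsClosed (E n) := by
    intro n
    simp only [E, Set.ofPred_forall]
    exact isClosed_iInter fun k => isClosed_le (hcont k) continuous_const
  have hU : ⋃ n, E n = Set.univ := by
    refine Set.eq_univ_of_forall fun a => ?_
    obtain ⟨c, hc⟩ := hd a
    obtain ⟨n, hn⟩ := exists_nat_ge c
    exact Set.mem_iUnion.2 ⟨n, fun k => (hc k).trans (by gcongr)⟩
  obtain ⟨n, a₀, ha₀⟩ := nonempty_interior_of_iUnion_of_closed hE hU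
  obtain ⟨r, hr, hball⟩ := Metric.isOpen_iff.1 isOpen_interior a₀ ha₀
  -- Writing `x = (a₀ + x) - a₀` doubles both the rank and the error bound.
  have hsmall : ∀ x : A, ‖x‖ < r → ∃ f, Approx s 2 (2 * ((n : ℝ) + 1)) (d x) f := by
    intro x hx
    have h1 : a₀ + x ∈ E n := interior_subset (hball (by simpa using hx))
    have h2 : a₀ ∈ E n := interior_subset ha₀
    obtain ⟨f, hf⟩ := Approx.of_singularValue_le h1 (lt_add_one (n : ℝ))
    obtain ⟨g, hg⟩ := Approx.of_singularValue_le h2 (lt_add_one (n : ℝ))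
    have h3 := hf.sub hg
    rw [← map_sub, add_sub_cancel_left] at h3
    exact ⟨_, h3.mono le_rfl (two_mul _).ge⟩
  refine ⟨4 * ((n : ℝ) + 1) / r, by positivity, fun a => ?_⟩
  rcases eq_or_ne a 0 with rfl | ha
  · exact ⟨fun _ => 0, fun _ => RankLE.zero _, fun _ => by simp⟩
  · have hna : 0 < ‖a‖ := norm_pos_iff.2 ha
    obtain ⟨f, hf⟩ := hsmall (((r / (2 * ‖a‖) : ℝ) : ℂ) • a) (by
      rw [norm_smul, Complex.norm_real, Real.norm_of_nonneg (by positivity)]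
      field_simp
      linarith)
    have h4 := hf.smul ((2 * ‖a‖ / r : ℝ) : ℂ)
    rw [map_smul, smul_smul, ← Complex.ofReal_mul,
      show 2 * ‖a‖ / r * (r / (2 * ‖a‖)) = 1 by field_simp, Complex.ofReal_one, one_smul,
      Complex.norm_real, Real.norm_of_nonneg (by positivity)] at h4
    exact ⟨_, h4.mono le_rfl (le_of_eq (by field_simp; ring))⟩

end WeakSchatten

/-! ### Words in a derivation -/

section Words

variable {A R : Type*}

/-- `d a₀ ⋯ d a_{n-1}`. -/
def word [Monoid R] (d : A → R) {n : ℕ} (a : Fin n → A) : R :=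
  (List.ofFn fun i => d (a i)).prod

theorem word_succ [Monoid R] (d : A → R) {n : ℕ} (a : Fin (n + 1) → A) :
    word d a = d (a 0) * word d fun i => a i.succ := by
  simp [word, List.ofFn_succ]

theorem word_castSucc [Monoid R] (d : A → R) {n : ℕ} (a : Fin (n + 1) → A) :
    word d a = (word d fun i => a i.castSucc) * d (a (Fin.last n)) := by
  rw [word, List.ofFn_succ', List.concat_eq_append, List.prod_append, List.prod_singleton, word]

section Face

variable [Mul A] {n : ℕ}

theorem face_zero_zero (a : Fin (n + 2) → A) : face 0 a 0 = a 0 * a 1 := by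
  simp [face]

theorem face_zero_succ (a : Fin (n + 3) → A) (i : Fin (n + 1)) :
    face 0 a i.succ = a i.succ.succ := by
  simp [face, Fin.succ_ne_zero]

theorem face_succ_zero (a : Fin (n + 3) → A) (j : Fin (n + 1)) : face j.succ a 0 = a 0 := by
  simp [face]

theorem face_succ_succ (a : Fin (n + 3) → A) (j i : Fin (n + 1)) :
    face j.succ a i.succ = face j (fun i => a i.succ) i := by
  simp [face]

theorem lastFace_zero (a : Fin (n + 2) → A) : lastFace a 0 = a (Fin.last (n + 1)) * a 0 := by
  simp [lastFace]

theorem lastFace_succ (a : Fin (n + 3) → A) (i : Fin (n + 1)) :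
    lastFace a i.succ = a i.succ.castSucc := by
  simp [lastFace, Fin.succ_ne_zero]

end Face

variable [Ring R] [Algebra ℂ R] {ρ d : A → R}

/-- The anticommutation needs a factor on the left. Once `F` has passed the first letter, that
letter takes over the role of `y`, so the induction must vary `y`. -/
theorem mul_word_comm_of_anticomm {F : R}
    (hF : ∀ b c, d b * (F * d c + d c * F) = 0) {y : R}
    (hy : ∀ c, y * (F * d c + d c * F) = 0) {n : ℕ} (a : Fin n → A) :
    y * (F * word d a) = (-1 : ℂ) ^ n • (y * (word d a * F)) := by
  induction n generalizing y with
  | zero => simp [word]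
  | succ n ih =>
    have h1 : y * (F * d (a 0)) = -(y * (d (a 0) * F)) := by
      rw [eq_neg_iff_add_eq_zero, ← mul_add]
      exact hy _
    have h2 := ih (hF (a 0)) fun i => a i.succ
    rw [word_succ, ← mul_assoc F, ← mul_assoc y, h1, pow_succ, mul_neg_one, neg_smul, neg_mul,
      mul_assoc, mul_assoc, h2, mul_smul_comm]
    simp only [mul_assoc]

theorem mul_word_of_sign {g : R} {ε : ℂ} (hg : ∀ b, g * d b = ε • (d b * g)) {n : ℕ}
    (a : Fin n → A) : g * word d a = ε ^ n • (word d a * g) := by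
  induction n with
  | zero => simp [word]
  | succ n ih =>
    rw [word_succ, ← mul_assoc, hg, smul_mul_assoc, mul_assoc, ih, pow_succ', mul_smul,
      mul_smul_comm, mul_assoc]

variable [Mul A]

/-- By the Leibniz rule each face splits in two, and the terms with `ρ` applied to an inner entry
cancel between neighbouring faces; the two ends survive. -/
theorem sum_word_face (hd : ∀ a b, d (a * b) = d a * ρ b + ρ a * d b) {n : ℕ}
    (a : Fin (n + 2) → A) :
    ∑ j : Fin (n + 1), (-1 : ℂ) ^ (j : ℕ) • word d (face j a) =
      ρ (a 0) * (word d fun i => a i.succ) +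
        (-1 : ℂ) ^ n • ((word d fun i => a i.castSucc) * ρ (a (Fin.last (n + 1)))) := by
  induction n with
  | zero =>
    have h0 : d (face 0 a 0) = ρ (a 0) * d (a 1) + d (a 0) * ρ (a 1) := by
      rw [face_zero_zero, hd]
      exact add_comm _ _
    simpa [word] using h0
  | succ n ih =>
    have h0 : word d (face 0 a) = d (a 0 * a 1) * word d fun i => a i.succ.succ := by
      rw [word_succ, face_zero_zero]
      simp only [face_zero_succ]
    have hs : ∀ j : Fin (n + 1), word d (face j.succ a) =
        d (a 0) * word d (face j fun i => a i.succ) := by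
      intro j
      rw [word_succ, face_succ_zero]
      simp only [face_succ_succ]
    rw [Fin.sum_univ_succ, h0]
    simp only [hs, Fin.val_succ, pow_succ, mul_neg, mul_one, neg_smul, Fin.val_zero, pow_zero,
      one_smul, Finset.sum_neg_distrib, ← mul_smul_comm]
    rw [← Finset.mul_sum, ih fun i => a i.succ, word_succ d fun i => a i.succ,
      word_succ d fun i => a i.castSucc, hd]
    simp only [Fin.succ_zero_eq_one, Fin.succ_last, Fin.castSucc_zero, Fin.succ_castSucc,
      add_mul, mul_add, mul_assoc, mul_smul_comm]
    abel

/-- Face `0` cancels the left end left over by `sum_word_face`. -/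
theorem sum_mul_word_face (hρ : ∀ a b, ρ (a * b) = ρ a * ρ b)
    (hd : ∀ a b, d (a * b) = d a * ρ b + ρ a * d b) {n : ℕ} (a : Fin (n + 3) → A) :
    ∑ j : Fin (n + 2), (-1 : ℂ) ^ (j : ℕ) • (ρ (face j a 0) * word d fun i => face j a i.succ) =
      (-1 : ℂ) ^ (n + 1) • (ρ (a 0) * (word d fun i => a i.castSucc.succ) *
        ρ (a (Fin.last (n + 2)))) := by
  rw [Fin.sum_univ_succ]
  simp only [face_zero_zero, face_zero_succ, face_succ_zero, face_succ_succ, Fin.val_succ,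
    pow_succ, mul_neg, mul_one, neg_smul, Fin.val_zero, pow_zero, one_smul,
    Finset.sum_neg_distrib, ← mul_smul_comm, ← Finset.mul_sum]
  have := sum_word_face (n := n) hd fun i => a i.succ
  rw [this, hρ]
  simp only [Fin.succ_zero_eq_one, Fin.succ_last, mul_add, mul_assoc, mul_smul_comm]
  abel

end Words

/-! ### The cochains of a Fredholm module -/

section Trace

variable {A : Type*} {H : Type*} [NormedAddCommGroup H] [InnerProductSpace ℂ H] {s : ℝ}

theorem exists_approx_word [SeminormedAddCommGroup A] {d : A → H →L[ℂ] H} {K : ℝ}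
    (hd : ∀ a, ∃ f, Approx s 2 (K * ‖a‖) (d a) f) {n : ℕ} (a : Fin n → A) :
    ∃ f, Approx (n * s) (2 * n) (K ^ n * ∏ i, ‖a i‖) (word d a) f := by
  induction n with
  | zero =>
    have h := Approx.of_norm_le (T := (1 : H →L[ℂ] H)) (D := 1) ContinuousLinearMap.norm_id_le
    exact ⟨fun _ => 0, by simpa [word] using h⟩
  | succ n ih =>
    obtain ⟨f, hf⟩ := hd (a 0)
    obtain ⟨g, hg⟩ := ih fun i => a i.succ
    have h := hf.mul hg
    rw [← word_succ, show s + n * s = (n + 1 : ℕ) * s by push_cast; ring] at h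
    refine ⟨_, h.mono (by omega) (le_of_eq ?_)⟩
    rw [Fin.prod_univ_succ]
    ring

theorem IsApprox.word {d : A → H →L[ℂ] H} (hd : ∀ a, IsApprox s (d a)) {n : ℕ} (a : Fin n → A) :
    IsApprox (n * s) (word d a) := by
  induction n with
  | zero => simpa [SingChern.word] using IsApprox.of_bounded (1 : H →L[ℂ] H)
  | succ n ih =>
    have h := (hd (a 0)).mul (ih fun i => a i.succ)
    rwa [← word_succ, show s + n * s = (n + 1 : ℕ) * s by push_cast; ring] at h

end Trace

/-- The algebraic content of a strict Fredholm module with grading operator `γ`. -/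
structure CommutatorSystem (A : Type*) [Mul A] {H : Type*} [NormedAddCommGroup H]
    [InnerProductSpace ℂ H] (p : ℕ) (F γ : H →L[ℂ] H) (ρ d : A → H →L[ℂ] H) : Prop where
  map_mul : ∀ a b, ρ (a * b) = ρ a * ρ b
  comm : ∀ a, d a = F * ρ a - ρ a * F
  grading_rep : ∀ a, γ * ρ a = ρ a * γ
  grading_comm : ∀ a, γ * d a = (-1 : ℂ) ^ (p + 1) • (d a * γ)
  rep_anticomm : ∀ a b, ρ a * (F * d b + d b * F) = 0
  comm_anticomm : ∀ a b, d a * (F * d b + d b * F) = 0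
  approx : ∀ a, IsApprox (1 / ((p : ℝ) + 1)) (d a)

/-! ### Cocycle identities and cyclicity under the Dixmier trace -/

namespace CommutatorSystem

variable {A : Type*} [Mul A] {H : Type*} [NormedAddCommGroup H]
  [InnerProductSpace ℂ H] {p : ℕ} {F γ : H →L[ℂ] H} {ρ d : A → H →L[ℂ] H}
  (S : CommutatorSystem A p F γ ρ d)

include S

theorem derivation (a b : A) : d (a * b) = d a * ρ b + ρ a * d b := by
  simp only [S.comm, S.map_mul]
  noncomm_ring

theorem grading_word {n : ℕ} (a : Fin n → A) :
    γ * word d a = (-1 : ℂ) ^ ((p + 1) * n) • (word d a * γ) := by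
  rw [pow_mul]
  exact mul_word_of_sign S.grading_comm a

theorem grading_word_p (a : Fin p → A) : γ * word d a = word d a * γ := by
  rw [S.grading_word, (show Even ((p + 1) * p) by rw [mul_comm]; exact Nat.even_mul_succ_self p)
    |>.neg_one_pow, one_smul]

theorem approx_word (a : Fin (p + 1) → A) : IsApprox 1 (word d a) := by
  have := IsApprox.word S.approx a
  rwa [show ((p + 1 : ℕ) : ℝ) * (1 / ((p : ℝ) + 1)) = 1 by push_cast; field_simp] at this

variable [CompleteSpace H] (ω : ExtendedLimit)

/-- Modulo products of `p + 2` commutators, `ρ y` can be moved around the trace. -/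
theorem trace_rotate {X : H →L[ℂ] H} (hX : IsApprox 1 X) (y : A) :
    dixmierTrace ω (γ * (F * (X * ρ y))) = dixmierTrace ω (γ * (F * (ρ y * X))) := by
  have h1 : IsApprox 1 (γ * (F * X)) := (hX.bounded_mul F).bounded_mul γ
  have h2 := h1.dixmierTrace_mul_comm ω (IsApprox.of_bounded (ρ y)) (add_zero 1)
  have h3 : ρ y * (γ * (F * X)) = γ * (ρ y * F * X) := by
    rw [← mul_assoc, ← S.grading_rep]; simp only [mul_assoc]
  have h4 : γ * (F * (ρ y * X)) = γ * (ρ y * F * X) + (γ * d y) * X := by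
    rw [S.comm]; noncomm_ring
  -- The correction `γ * d y * X` is a product of an operator of positive order and one of order
  -- `1`, so its trace is zero.
  rw [h4, IsApprox.dixmierTrace_add ω ((hX.bounded_mul _).bounded_mul γ) (hX.bounded_mul _),
    IsApprox.dixmierTrace_mul_eq_zero ω (s := 1 / ((p : ℝ) + 1)) (by positivity)
      ((S.approx y).bounded_mul γ) hX, add_zero, ← h3, ← h2]
  simp only [mul_assoc]

/-- The telescoped sum has a factor `ρ` of the last entry at the right end; `trace_rotate` brings it
to the front, where it cancels the last face. -/
theorem hochschild_sum_eq_zero (a : Fin (p + 3) → A) :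
    ∑ j : Fin (p + 2), (-1 : ℂ) ^ (j : ℕ) *
        dixmierTrace ω (γ * (F * (ρ (face j a 0) * word d fun i => face j a i.succ))) +
      (-1 : ℂ) ^ (p + 2) *
        dixmierTrace ω (γ * (F * (ρ (lastFace a 0) * word d fun i => lastFace a i.succ))) = 0 := by
  have hX : IsApprox 1 (ρ (a 0) * word d fun i => a i.castSucc.succ) :=
    (S.approx_word _).bounded_mul _
  rw [← dixmierTrace_sum_smul ω _ _ fun j =>
    (((S.approx_word _).bounded_mul _).bounded_mul F).bounded_mul γ]
  have hs : ∑ j : Fin (p + 2), (-1 : ℂ) ^ (j : ℕ) •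
      (γ * (F * (ρ (face j a 0) * word d fun i => face j a i.succ))) =
      γ * (F * ∑ j : Fin (p + 2), (-1 : ℂ) ^ (j : ℕ) •
        (ρ (face j a 0) * word d fun i => face j a i.succ)) := by
    simp only [Finset.mul_sum, mul_smul_comm]
  rw [hs, sum_mul_word_face S.map_mul S.derivation, mul_smul_comm, mul_smul_comm,
    IsApprox.dixmierTrace_smul ω (((hX.mul_bounded _).bounded_mul F).bounded_mul γ),
    S.trace_rotate ω hX, lastFace_zero, S.map_mul]
  simp only [lastFace_succ, Fin.succ_castSucc, mul_assoc]
  ring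

theorem cyclic_sum_eq_zero (a : Fin (p + 2) → A) :
    ∑ j : Fin (p + 1), (-1 : ℂ) ^ (j : ℕ) * dixmierTrace ω (γ * (F * word d (face j a))) +
      (-1 : ℂ) ^ (p + 1) * dixmierTrace ω (γ * (F * word d (lastFace a))) = 0 := by
  set D := word d fun i : Fin p => a i.castSucc.succ with hD
  set z := a (Fin.last (p + 1)) with hz
  have hDz : IsApprox 1 (D * d z) := by
    have := S.approx_word fun i => a i.succ
    rwa [word_castSucc] at this
  have hX : IsApprox 1 (d (a 0) * D) := by
    have := S.approx_word fun i => a i.castSucc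
    rwa [word_succ] at this
  have hdz := (S.approx z).bounded_mul (γ * F)
  have hsum : 1 / ((p : ℝ) + 1) + p * (1 / ((p : ℝ) + 1)) = 1 := by field_simp; ring
  have hDa : IsApprox (p * (1 / ((p : ℝ) + 1))) (ρ (a 0) * D) :=
    (IsApprox.word S.approx _).bounded_mul _
  have hzD : IsApprox 1 (d z * (ρ (a 0) * D)) := by
    have := (S.approx z).mul hDa
    rwa [hsum] at this
  have e1 : word d (lastFace a) = d z * (ρ (a 0) * D) + ρ z * (d (a 0) * D) := by
    have h1 : word d (lastFace a) =
        d (lastFace a 0) * word d fun i => lastFace a i.succ := word_succ _ _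
    have h2 : (fun i : Fin p => lastFace a i.succ) = fun i => a i.succ.castSucc := by
      funext i
      simp [lastFace, Fin.succ_ne_zero]
    rw [h1, lastFace_zero, S.derivation]
    simp only [funext_iff] at h2
    simp only [h2, hD, Fin.succ_castSucc, add_mul, mul_assoc, hz]
  have e2 : ∑ j : Fin (p + 1), (-1 : ℂ) ^ (j : ℕ) • word d (face j a) =
      ρ (a 0) * (D * d z) + (-1 : ℂ) ^ p • (d (a 0) * D * ρ z) := by
    rw [sum_word_face S.derivation, word_castSucc d fun i => a i.succ,
      word_succ d fun i : Fin (p + 1) => a i.castSucc]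
    simp only [hD, hz, Fin.succ_castSucc, Fin.castSucc_zero, Fin.succ_last]
  -- Moving `F` past `ρ (a 0)` costs a term of vanishing trace, moving it past `D` gives `(-1)^p`,
  -- and `γ` commutes with both; the trace property then carries `ρ (a 0) * D` to the end. The other
  -- pair of terms is matched by `trace_rotate`.
  have t1 : dixmierTrace ω (γ * (F * (ρ (a 0) * (D * d z)))) =
      (-1 : ℂ) ^ p * dixmierTrace ω (γ * (F * (d z * (ρ (a 0) * D)))) := by
    have h1 : γ * (F * (ρ (a 0) * (D * d z))) =
        (-1 : ℂ) ^ p • (γ * (ρ (a 0) * (D * F) * d z)) + (γ * d (a 0)) * (D * d z) := by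
      have h := mul_word_comm_of_anticomm S.comm_anticomm (S.rep_anticomm (a 0))
        fun i : Fin p => a i.castSucc.succ
      rw [← hD] at h
      have h' : F * ρ (a 0) = d (a 0) + ρ (a 0) * F := by rw [S.comm]; abel
      calc γ * (F * (ρ (a 0) * (D * d z))) = γ * ((F * ρ (a 0)) * (D * d z)) := by
            simp only [mul_assoc]
        _ = γ * ((ρ (a 0) * (F * D)) * d z) + (γ * d (a 0)) * (D * d z) := by
            rw [h']; noncomm_ring
        _ = _ := by rw [h, smul_mul_assoc, mul_smul_comm]
    have h2 : γ * (ρ (a 0) * (D * F) * d z) = (ρ (a 0) * D) * (γ * F * d z) := by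
      have := S.grading_word_p fun i : Fin p => a i.castSucc.succ
      rw [← hD] at this
      calc _ = γ * ρ (a 0) * D * F * d z := by simp only [mul_assoc]
        _ = ρ (a 0) * (γ * D) * F * d z := by rw [S.grading_rep]; simp only [mul_assoc]
        _ = _ := by rw [this]; simp only [mul_assoc]
    have h3 : IsApprox 1 ((ρ (a 0) * D) * (γ * F * d z)) := by
      have := hDa.mul hdz
      rwa [add_comm, hsum] at this
    rw [h1, h2, IsApprox.dixmierTrace_add ω (h3.smul _) (hDz.bounded_mul _),
      IsApprox.dixmierTrace_mul_eq_zero ω (s := 1 / ((p : ℝ) + 1)) (by positivity)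
        ((S.approx (a 0)).bounded_mul γ) hDz, add_zero, h3.dixmierTrace_smul ω,
      hDa.dixmierTrace_mul_comm ω hdz ((add_comm _ _).trans hsum)]
    simp only [mul_assoc]
  have hFX : ∀ {T : H →L[ℂ] H}, IsApprox 1 T → IsApprox 1 (γ * (F * T)) := fun hT =>
    (hT.bounded_mul F).bounded_mul γ
  rw [← dixmierTrace_sum_smul ω _ _ fun j => hFX (S.approx_word _)]
  simp only [← mul_smul_comm, ← Finset.mul_sum]
  rw [e1, e2]
  simp only [mul_add, mul_smul_comm]
  rw [IsApprox.dixmierTrace_add ω (hFX (hDz.bounded_mul _)) ((hFX (hX.mul_bounded _)).smul _),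
    IsApprox.dixmierTrace_add ω (hFX hzD) (hFX (hX.bounded_mul _)),
    (hFX (hX.mul_bounded _)).dixmierTrace_smul ω, S.trace_rotate ω hX, t1]
  ring

theorem trace_cyclic (a : Fin (p + 1) → A) :
    dixmierTrace ω (γ * (F * word d a)) =
      (-1 : ℂ) ^ p * dixmierTrace ω (γ * (F * word d (a ∘ finRotate (p + 1)))) := by
  cases p with
  | zero =>
    have : a ∘ finRotate (0 + 1) = a := by
      funext i
      rw [Function.comp_apply]
      congr 1
      exact Subsingleton.elim (α := Fin 1) _ _
    rw [this]
    simp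
  -- A nonempty `D` has a first letter `d (a 1)`, behind which `F` anticommutes with the other
  -- letters. The defect at that letter is the anticommutator `e`.
  | succ m =>
    set σ : ℝ := 1 / (((m + 1 : ℕ) : ℝ) + 1) with hσ
    have hsum : σ + (m + 1 : ℕ) * σ = 1 := by rw [hσ]; field_simp; ring
    have hσ0 : 0 < σ := by positivity
    set D := word d fun i : Fin (m + 1) => a i.succ with hD
    set D' := word d fun i : Fin m => a i.succ.succ with hD'
    have e0 : word d a = d (a 0) * D := word_succ _ _
    have e1 : D = d (a 1) * D' := word_succ _ _
    have e2 : word d (a ∘ finRotate (m + 1 + 1)) = D * d (a 0) := by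
      rw [word_castSucc]
      simp only [Function.comp_apply, finRotate_last]
      congr 2
      funext i
      rw [finRotate_apply, Fin.coeSucc_eq_succ]
    have hDap : IsApprox ((m + 1 : ℕ) * σ) D := IsApprox.word S.approx _
    have hD'ap : IsApprox (m * σ) D' := IsApprox.word S.approx _
    have hda := S.approx (a 0)
    set e := F * d (a 1) + d (a 1) * F with he
    have hea : IsApprox σ e := ((S.approx _).bounded_mul F).add ((S.approx _).mul_bounded F)
    have heD : IsApprox ((m + 1 : ℕ) * σ) (γ * e * D') := by
      have := (hea.bounded_mul γ).mul hD'ap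
      rwa [show σ + m * σ = (m + 1 : ℕ) * σ by push_cast; ring] at this
    -- Under the trace, `d (a 0)` can be brought to the left of `e`, which it annihilates.
    have t0 : dixmierTrace ω (γ * e * D' * d (a 0)) = 0 := by
      rw [heD.dixmierTrace_mul_comm ω hda ((add_comm _ _).trans hsum)]
      have h1 : d (a 0) * γ = (-1 : ℂ) ^ (m + 1 + 1) • (γ * d (a 0)) := by
        rw [S.grading_comm, smul_smul, ← mul_pow]
        simp
      have h2 : d (a 0) * (γ * e * D') = 0 := by
        calc _ = (d (a 0) * γ) * e * D' := by simp only [mul_assoc]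
          _ = (-1 : ℂ) ^ (m + 1 + 1) • (γ * (d (a 0) * e) * D') := by
            rw [h1]; simp only [smul_mul_assoc, mul_assoc]
          _ = 0 := by rw [S.comm_anticomm]; simp
      rw [h2]
      exact (dixmierLinear ω).map_zero
    have h1 : D * F = (-1 : ℂ) ^ m • (e * D' - F * D) := by
      have h := mul_word_comm_of_anticomm S.comm_anticomm (S.comm_anticomm (a 1))
        fun i : Fin m => a i.succ.succ
      rw [← hD'] at h
      have h' : D * F = (-1 : ℂ) ^ m • (d (a 1) * (F * D')) := by
        rw [h, smul_smul, ← mul_pow, e1]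
        simp [mul_assoc]
      rw [h', e1, he]
      congr 1
      noncomm_ring
    have h2 : D * (γ * (F * d (a 0))) =
        (-1 : ℂ) ^ m • (γ * e * D' * d (a 0) + (-1 : ℂ) • (γ * (F * (D * d (a 0))))) := by
      calc _ = (D * γ) * (F * d (a 0)) := by simp only [mul_assoc]
        _ = γ * (D * F) * d (a 0) := by
          rw [hD, ← S.grading_word_p]; simp only [mul_assoc]
        _ = _ := by
          rw [h1, mul_smul_comm, smul_mul_assoc]
          congr 1
          rw [neg_one_smul]
          noncomm_ring
    have hap1 : IsApprox 1 (γ * e * D' * d (a 0)) := by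
      have := heD.mul hda
      rwa [add_comm, hsum] at this
    have hap2 : IsApprox 1 (γ * (F * (D * d (a 0)))) := by
      have := hDap.mul hda
      rw [add_comm, hsum] at this
      exact (this.bounded_mul F).bounded_mul γ
    have h3 : γ * (F * (d (a 0) * D)) = (γ * (F * d (a 0))) * D := by simp only [mul_assoc]
    rw [e0, e2, h3, IsApprox.dixmierTrace_mul_comm ω ((hda.bounded_mul F).bounded_mul γ) hDap hsum,
      h2, (hap1.add (hap2.smul _)).dixmierTrace_smul ω, hap1.dixmierTrace_add ω (hap2.smul _),
      hap2.dixmierTrace_smul ω, t0]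
    ring

end CommutatorSystem

/-- Split `T = R + (T - R)` with `R` of finite rank; the second part contributes `O(ε)` with a rank
constant independent of `ε`. -/
theorem dixmierTrace_eq_zero_of_weakSchattenZero {H : Type*} [NormedAddCommGroup H]
    [InnerProductSpace ℂ H] [CompleteSpace H] (ω : ExtendedLimit) {q t : ℝ} (h : 1 / q + t = 1)
    {T Y : H →L[ℂ] H} (hT : IsWeakSchattenZero q T) (hY : IsApprox t Y) (L : H →L[ℂ] H) :
    dixmierTrace ω (L * (T * Y)) = 0 := by
  obtain ⟨C, D, g, hY⟩ := hY
  refine dixmierTrace_eq_zero_of_approx ω (C := 0 + (1 + C)) (K := ‖L‖ * (2 * D)) fun ε hε => ?_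
  obtain ⟨R, f, hR, hf⟩ := hT.exists_approx hε
  have h1 := (Approx.of_norm_le (le_refl ‖L‖)).mul (hf.mul hY)
  rw [h, zero_add, show ‖L‖ * (2 * ε * D) = ‖L‖ * (2 * D) * ε by ring] at h1
  have hR' : RankLE (Module.finrank ℂ R.range) R := ⟨hR, le_rfl⟩
  exact ⟨L * (R * Y), _, _, ((hR'.mul_right Y).mul_left L).1, h1, by noncomm_ring⟩

section TraceCochain

variable {A : Type*} [NonUnitalNormedRing A] [NormedSpace ℂ A]
  {H : Type*} [NormedAddCommGroup H] [InnerProductSpace ℂ H] [CompleteSpace H]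

/-- The cochain `a ↦ Tr_ω (m a)` of a multilinear map with bounded values in `𝓛^{1,∞}`. -/
def traceCochain (ω : ExtendedLimit) {n : ℕ}
    (m : MultilinearMap ℂ (fun _ : Fin (n + 1) => A) (H →L[ℂ] H)) (C : ℕ) (K : ℝ)
    (hm : ∀ a, ∃ f, Approx 1 C (K * ∏ i, ‖a i‖) (m a) f) : Cochain A n :=
  MultilinearMap.mkContinuous
    ((dixmierLinear ω).compMultilinearMap
      (m.codRestrict (approxOne H) fun a => ⟨_, _, _, (hm a).choose_spec⟩))
    (‖ω.toFun‖ * (24 * C * K)) fun a => by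
      obtain ⟨f, hf⟩ := hm a
      refine (hf.norm_dixmierTrace_le ω).trans_eq ?_
      ring

theorem traceCochain_apply (ω : ExtendedLimit) {n : ℕ}
    (m : MultilinearMap ℂ (fun _ : Fin (n + 1) => A) (H →L[ℂ] H)) (C : ℕ) (K : ℝ)
    (hm : ∀ a, ∃ f, Approx 1 C (K * ∏ i, ‖a i‖) (m a) f) (a : Fin (n + 1) → A) :
    traceCochain ω m C K hm a = dixmierTrace ω (m a) := rfl

end TraceCochain

/-! ### From strict summable Fredholm modules to bounded cochains -/

namespace FredholmModule

variable {A : Type*} [NonUnitalNormedRing A] [NormedSpace ℂ A]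
  {H : Type*} [NormedAddCommGroup H] [InnerProductSpace ℂ H] [CompleteSpace H]
  (M : FredholmModule A H)

/-- The representation as a continuous linear map. -/
def repL : A →L[ℂ] H →L[ℂ] H := ⟨(M.π : A →ₗ[ℂ] H →L[ℂ] H), M.continuous_π⟩

/-- The derivation `a ↦ [F, a]` as a continuous linear map. -/
def commL : A →L[ℂ] H →L[ℂ] H :=
  (ContinuousLinearMap.mul ℂ (H →L[ℂ] H) M.F -
    (ContinuousLinearMap.mul ℂ (H →L[ℂ] H)).flip M.F).comp M.repL

theorem repL_apply (a : A) : M.repL a = M.π a := rfl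

theorem commL_apply (a : A) : M.commL a = M.F * M.π a - M.π a * M.F := rfl

variable {M}

theorem IsWeaklySummable.exists_uniform_approx [CompleteSpace A] {p : ℕ}
    (h : M.IsWeaklySummable ((p : ℝ) + 1)) :
    ∃ K, 0 ≤ K ∧ ∀ a, ∃ f, Approx (1 / ((p : ℝ) + 1)) 2 (K * ‖a‖) (M.commL a) f :=
  SingChern.exists_uniform_approx M.commL fun a =>
    (h (M.π a) ⟨a, Or.inl rfl⟩).1.exists_singularValue_le (by positivity)

/-- Strictness enters as `π(a)(F² - 1) = 0`: then `F[F,b] + [F,b]F = (F² - 1)π(b)`, which vanishes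
after left multiplication by `π(a)` or `[F,a]`. The sign `(-1)^{p+1}` covers both parities, `γ`
being `1` for odd `p`. -/
theorem commutatorSystem [CompleteSpace A] {p : ℕ} {γ : H →L[ℂ] H} (hpar : M.HasParity p γ)
    (hst : M.IsStrict) (hsum : M.IsWeaklySummable ((p : ℝ) + 1)) :
    CommutatorSystem A p M.F γ M.π M.commL := by
  have h1 : ∀ a, M.π a * (M.F ^ 2 - 1) = 0 := fun a => (hst _ ⟨a, Or.inl rfl⟩).2
  have h2 : ∀ b, M.F * M.commL b + M.commL b * M.F = (M.F ^ 2 - 1) * M.π b := by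
    intro b
    have : M.F * M.commL b + M.commL b * M.F =
        (M.F ^ 2 - 1) * M.π b - M.π b * (M.F ^ 2 - 1) := by
      rw [commL_apply]
      noncomm_ring
    rw [this, h1, sub_zero]
  refine ⟨fun a b => map_mul M.π a b, M.commL_apply, hpar.even_π, fun a => ?_, fun a b => ?_,
    fun a b => ?_, fun a => ?_⟩
  · rcases Nat.even_or_odd p with hp | hp
    · have hF := hpar.odd_F hp
      rw [hp.add_one.neg_one_pow, neg_one_smul, commL_apply, mul_sub, sub_mul, ← mul_assoc, hF,
        ← mul_assoc, hpar.even_π, mul_assoc (M.π a), hF, neg_mul, mul_assoc M.F γ, hpar.even_π]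
      noncomm_ring
    · rw [hp.add_one.neg_one_pow, hpar.ungraded hp]
      simp
  · rw [h2, ← mul_assoc, h1, zero_mul]
  · have h3 : M.commL a * ((M.F ^ 2 - 1) * M.π b) =
        M.F * (M.π a * (M.F ^ 2 - 1)) * M.π b - M.π a * (M.F ^ 2 - 1) * M.F * M.π b := by
      rw [commL_apply]
      noncomm_ring
    rw [h2, h3, h1]
    simp
  · obtain ⟨K, -, hK⟩ := hsum.exists_uniform_approx
    exact ⟨_, _, _, (hK a).choose_spec⟩

theorem cyclicCochain_eq (γ : H →L[ℂ] H) (ω : ExtendedLimit) (p : ℕ) (a : Fin (p + 1) → A) :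
    M.cyclicCochain γ ω p a = dixmierTrace ω (γ * (M.F * word M.commL a)) := rfl

theorem hochschildCochain_eq (γ : H →L[ℂ] H) (ω : ExtendedLimit) (p : ℕ) (a : Fin (p + 2) → A) :
    M.hochschildCochain γ ω p a =
      p * dixmierTrace ω (γ * (M.F * (M.π (a 0) * word M.commL fun i => a i.succ))) := by
  rw [← mul_assoc M.F]
  rfl

theorem exists_cyclicCochain [CompleteSpace A] {p : ℕ} (hsum : M.IsWeaklySummable ((p : ℝ) + 1))
    (γ : H →L[ℂ] H) (ω : ExtendedLimit) :
    ∃ φ : Cochain A p, ∀ a, φ a = M.cyclicCochain γ ω p a := by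
  obtain ⟨K, -, hK⟩ := hsum.exists_uniform_approx
  let m : MultilinearMap ℂ (fun _ : Fin (p + 1) => A) (H →L[ℂ] H) :=
    (LinearMap.mulLeft ℂ (γ * M.F)).compMultilinearMap
      ((MultilinearMap.mkPiAlgebraFin ℂ (p + 1) (H →L[ℂ] H)).compLinearMap
        fun _ => (M.commL : A →ₗ[ℂ] H →L[ℂ] H))
  have hm : ∀ a, m a = γ * M.F * word M.commL a := fun a => by simp [m, word, mul_assoc]
  refine ⟨traceCochain ω m (0 + 2 * (p + 1)) (‖γ * M.F‖ * K ^ (p + 1)) fun a => ?_, fun a => ?_⟩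
  · obtain ⟨f, hf⟩ := exists_approx_word hK a
    have h := (Approx.of_norm_le (le_refl ‖γ * M.F‖)).mul hf
    rw [show (0 : ℝ) + ((p + 1 : ℕ) : ℝ) * (1 / ((p : ℝ) + 1)) = 1 by push_cast; field_simp; ring,
      ← mul_assoc, ← hm] at h
    exact ⟨_, h⟩
  · rw [traceCochain_apply, hm, cyclicCochain_eq, mul_assoc]

theorem exists_hochschildCochain [CompleteSpace A] {p : ℕ}
    (hsum : M.IsWeaklySummable ((p : ℝ) + 1)) (γ : H →L[ℂ] H) (ω : ExtendedLimit) :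
    ∃ φ : Cochain A (p + 1), ∀ a, φ a = M.hochschildCochain γ ω p a := by
  obtain ⟨K, -, hK⟩ := hsum.exists_uniform_approx
  let m : MultilinearMap ℂ (fun _ : Fin (p + 2) => A) (H →L[ℂ] H) :=
    (LinearMap.mulLeft ℂ (γ * M.F)).compMultilinearMap
      ((MultilinearMap.mkPiAlgebraFin ℂ (p + 2) (H →L[ℂ] H)).compLinearMap
        fun i => if i = 0 then (M.repL : A →ₗ[ℂ] H →L[ℂ] H) else (M.commL : A →ₗ[ℂ] H →L[ℂ] H))
  have hm : ∀ a, m a = γ * M.F * (M.π (a 0) * word M.commL fun i => a i.succ) := fun a => by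
    simp [m, word, List.ofFn_succ, Fin.succ_ne_zero, repL_apply, mul_assoc]
  refine ⟨(p : ℂ) • traceCochain ω m (0 + (0 + 2 * (p + 1)))
    (‖γ * M.F‖ * (‖M.repL‖ * K ^ (p + 1))) fun a => ?_, fun a => ?_⟩
  · obtain ⟨f, hf⟩ := exists_approx_word hK fun i => a i.succ
    have h := (Approx.of_norm_le (le_refl ‖γ * M.F‖)).mul
      ((Approx.of_norm_le (M.repL.le_opNorm (a 0))).mul hf)
    rw [show (0 : ℝ) + (0 + ((p + 1 : ℕ) : ℝ) * (1 / ((p : ℝ) + 1))) = 1 by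
      push_cast; field_simp; ring, repL_apply, ← hm] at h
    refine ⟨_, h.mono le_rfl (le_of_eq ?_)⟩
    rw [Fin.prod_univ_succ fun i => ‖a i‖]
    ring
  · rw [smul_apply, traceCochain_apply, hm, hochschildCochain_eq, mul_assoc, smul_eq_mul]

end FredholmModule

end SingChern

end

/-! ### The main theorem -/

open SingChern in
theorem mainTheorem5
    {A : Type*} [NonUnitalNormedRing A] [NormedSpace ℂ A] [IsScalarTower ℂ A A]
    [SMulCommClass ℂ A A] [CompleteSpace A]
    {A₀ : Type*} [NonUnitalNormedRing A₀] [NormedSpace ℂ A₀] [IsScalarTower ℂ A₀ A₀]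
    [SMulCommClass ℂ A₀ A₀] [CompleteSpace A₀]
    {H : Type*} [NormedAddCommGroup H] [InnerProductSpace ℂ H] [CompleteSpace H]
    (p : ℕ) (M : FredholmModule A H) (γ : H →L[ℂ] H) (hparity : M.HasParity p γ)
    (hstrict : M.IsStrict) (hsummable : M.IsWeaklySummable ((p : ℝ) + 1))
    (ω : ExtendedLimit)
    (j : A₀ →ₙₐ[ℂ] A) (hj : Continuous j) (hinj : Function.Injective j)
    (hzero : ∀ a : A₀, IsWeakSchattenZero ((p : ℝ) + 1) ⁅M.F, M.π (j a)⁆) :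
    (∃ h : hochschildZ A (p + 1),
      (∀ a, (h : Cochain A (p + 1)) a = M.hochschildCochain γ ω p a) ∧
        HH.map j hj (p + 1) (HH.mk h) = 0) ∧
    (∃ c : cyclicZ A p,
      (∀ a, (c : Cochain A p) a = M.cyclicCochain γ ω p a) ∧
        HC.map j hj p (HC.mk c) = 0) := by
  have S := FredholmModule.commutatorSystem hparity hstrict hsummable
  have hsum : 1 / ((p : ℝ) + 1) + p * (1 / ((p : ℝ) + 1)) = 1 := by field_simp; ring
  -- The first commutator lies in `𝓛₀^{p+1,∞}`, the other `p` have total order `p / (p + 1)`; `L`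
  -- will be `γ F` or `γ F π(a₀)`.
  have hvan : ∀ (L : H →L[ℂ] H) (a : Fin (p + 1) → A₀),
      dixmierTrace ω (L * word M.commL fun i => j (a i)) = 0 := by
    intro L a
    rw [word_succ]
    exact dixmierTrace_eq_zero_of_weakSchattenZero ω hsum (hzero (a 0))
      (IsApprox.word S.approx _) L
  obtain ⟨φ, hφ⟩ := FredholmModule.exists_hochschildCochain hsummable γ ω
  obtain ⟨ψ, hψ⟩ := FredholmModule.exists_cyclicCochain hsummable γ ω
  have hφZ : φ ∈ hochschildZ A (p + 1) := by
    rw [hochschildZ, LinearMap.mem_ker]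
    ext a
    have h := congrArg (fun z : ℂ => (p : ℂ) * z) (S.hochschild_sum_eq_zero ω a)
    simp only [mul_zero, mul_add, Finset.mul_sum, mul_left_comm (p : ℂ)] at h
    simp only [hochschildB_apply, hφ, FredholmModule.hochschildCochain_eq, zero_apply]
    exact h
  have hψZ : ψ ∈ cyclicZ A p := by
    refine ⟨fun a => ?_, ?_⟩
    · rw [hψ, hψ]
      exact S.trace_cyclic ω a
    · rw [hochschildZ, SetLike.mem_coe, LinearMap.mem_ker]
      ext a
      simp only [hochschildB_apply, hψ, FredholmModule.cyclicCochain_eq, zero_apply]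
      exact S.cyclic_sum_eq_zero ω a
  -- The pulled back cochain itself is zero, so its class is zero without any choice of primitive.
  have hφ0 : pullback j hj (p + 1) φ = 0 := by
    ext a
    rw [pullback_apply, hφ, FredholmModule.hochschildCochain_eq, ← mul_assoc, ← mul_assoc,
      hvan _ fun i => a i.succ]
    simp
  have hψ0 : pullback j hj p ψ = 0 := by
    ext a
    rw [pullback_apply, hψ, FredholmModule.cyclicCochain_eq, ← mul_assoc, hvan]
    rfl
  refine ⟨⟨⟨φ, hφZ⟩, hφ, ?_⟩, ⟨⟨ψ, hψZ⟩, hψ, ?_⟩⟩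
  · refine (Submodule.Quotient.mk_eq_zero _).2 ?_
    rw [Submodule.mem_comap]
    exact (congrArg (· ∈ hochschildCob A₀ (p + 1)) hφ0).mpr (zero_mem _)
  · refine (Submodule.Quotient.mk_eq_zero _).2 ?_
    rw [Submodule.mem_comap]
    exact (congrArg (· ∈ cyclicCob A₀ p) hψ0).mpr (zero_mem _)
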